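/- **Definitions.** Let $S$ be a string of length $n$, $S[i..]$ its suffix that starts at position $i$, and $\sigma_S$ the number of distinct characters in $S$. The parent distance encoding $\mathsf{PD}(S)$ is the sequence of length $n$ with $\mathsf{PD}(S)[i] = i - \max\{j < i : S[j] \le S[i]\}$ if such a $j$ exists, and $\mathsf{PD}(S)[i] = 0$ otherwise. Let $w_k = \mathsf{PD}(S[n-k+1..])$ for $1 \le k \le n$. The Cartesian-tree position heap $\mathsf{CPH}(S)$ is the trie that starts with the root $u_0 = \varepsilon$ only and into which, for $k = 1, \ldots, n$, the shortest prefix $u_k$ of $w_k$ that is not yet a node is inserted (nodes are identified with their path labels). It is edge-sorted if the out-going edges of every node are stored in increasing order of their labels. The maximal reach pointer of $u_k$, $1 \le k \le n$, is the deepest node $u_j$ of the complete $\mathsf{CPH}(S)$ that is a prefix of $w_k$. **Theorem.** On the word RAM with words of $\Theta(\log n)$ bits, for any string $S$ of length $n$ over an integer alphabet $\Sigma = [1..\sigma]$ of size $\sigma = n^{O(1)}$, the edge-sorted $\mathsf{CPH}(S)$ together with all maximal reach pointers can be computed in $O(n \log \sigma_S)$ time and $O(n)$ space. Here $O(n \log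 \sigma_S)$ is read as $O(n (1 + \log \sigma_S))$, so that the case $\sigma_S = 1$ is included; the constants depend only on the exponent in $\sigma = n^{O(1)}$. -/

import Mathlib

namespace CartesianHeap

/-! ### Parent distance encoding -/

section Encoding

variable {α : Type*} [LinearOrder α]

/-- The positions to the left of `i` that hold a value at most `S[i]` (positions start at `0`). -/
def leftLE (S : List α) (i : Fin S.length) : Finset (Fin S.length) :=
  Finset.univ.filter fun j => j < i ∧ S.get j ≤ S.get i

/-- The distance from `i` to the nearest position on its left that holds a value at most `S[i]`,
and `0` if there is no such position. -/
def parentDist (S : List α) (i : Fin S.length) : ℕ :=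
  if h : (leftLE S i).Nonempty then (i : ℕ) - ((leftLE S i).max' h : ℕ) else 0

/-- The parent distance encoding of a string. -/
def PD (S : List α) : List ℕ :=
  List.ofFn (parentDist S)

/-- The parent distance encodings of the non-empty suffixes of `S`, in increasing order of their
lengths: `⟨PD(S[n..]), …, PD(S[1..])⟩`. -/
def pdSuffixes (S : List α) : List (List ℕ) :=
  (List.range S.length).map fun k => PD (S.drop (S.length - (k + 1)))

end Encoding

/-! ### Sequence hash trees

A node of a trie is identified with the string that labels the path from the root to it. -/

section HashTree

variable {α : Type*} [DecidableEq α]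

/-- The shortest prefix of `w` that is not a node of `T` (`List.inits` lists the prefixes of `w` by
increasing length). The default `w` is used only if every prefix of `w` is a node of `T`. -/
def newNode (T : List (List α)) (w : List α) : List α :=
  (w.inits.find? fun p => decide (p ∉ T)).getD w

/-- The sequence hash tree of `W = ⟨w₁, …, wₖ⟩`, given by its nodes in the order of their insertion:
the root `u₀ = ε`, and then `u₁, …, uₖ`. -/
def sht (W : List (List α)) : List (List α) :=
  W.foldl (fun T w => T ++ [newNode T w]) [[]]

end HashTree

/-! ### The Cartesian-tree position heap -/

section Heap

variable {α : Type*} [LinearOrder α]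

/-- The Cartesian-tree position heap of `S`: its nodes `u₀, u₁, …, uₙ` in the order of insertion. -/
def cph (S : List α) : List (List ℕ) :=
  sht (pdSuffixes S)

/-- The node `uₖ`, for `k ≤ n`: the root for `k = 0`, and the node that is inserted for the suffix of
length `k` otherwise. -/
def node (S : List α) (k : ℕ) : List ℕ :=
  (cph S).getD k []

/-- The encoding `wₖ = PD(S[n-k+1..])` of the suffix of length `k`, for `1 ≤ k ≤ n`. -/
def code (S : List α) (k : ℕ) : List ℕ :=
  PD (S.drop (S.length - k))

/-- `(uₚ, c, uₖ)` is an edge of the heap. -/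
def IsEdge (S : List α) (p c k : ℕ) : Prop :=
  p ≤ S.length ∧ k ≤ S.length ∧ node S k = node S p ++ [c]

/-- The maximal reach pointer of `uₖ` is `uⱼ`: of all nodes that are prefixes of `wₖ`, the deepest one
is `uⱼ`. -/
def IsMaxReach (S : List α) (k j : ℕ) : Prop :=
  j ≤ S.length ∧ node S j <+: code S k ∧
    ∀ i ≤ S.length, node S i <+: code S k → (node S i).length ≤ (node S j).length

/-- Four arrays represent the edge-sorted heap of `S` with all its maximal reach pointers. The node
`uₖ` is represented by the number `k`, for `0 ≤ k ≤ n`. The out-going edges of `uₖ` are stored, by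
strictly increasing labels, at the positions `first k, …, first (k + 1) - 1` of the arrays `label`
(the label of the edge) and `child` (its lower end), and the maximal reach pointer of `uₖ` is stored
in `mrp k`. -/
structure IsSortedHeap (S : List α) (first label child mrp : ℕ → ℕ) : Prop where
  first_zero : first 0 = 0
  first_last : first (S.length + 1) = S.length
  first_le : ∀ k ≤ S.length, first k ≤ first (k + 1)
  edges : ∀ p ≤ S.length, ∀ c k,
    IsEdge S p c k ↔ ∃ e, first p ≤ e ∧ e < first (p + 1) ∧ label e = c ∧ child e = k
  sorted : ∀ p ≤ S.length, ∀ e e',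
    first p ≤ e → e < e' → e' < first (p + 1) → label e < label e'
  reach : ∀ k, 1 ≤ k → k ≤ S.length → IsMaxReach S k (mrp k)

end Heap

/-! ### The word RAM

The memory consists of registers and of arrays, which are numbered by natural numbers and hold words of
`w` bits. A program is a finite text, so that it uses constantly many registers and arrays. Every
array has `M` cells, and a program that leaves the range of an array has no run; a program that
runs to its end thus uses `O(M)` words. -/

/-- Expressions over the registers. -/
inductive Expr where
  | const : ℕ → Expr
  | reg : ℕ → Expr
  | add : Expr → Expr → Expr
  | sub : Expr → Expr → Expr
  | mul : Expr → Expr → Expr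
  | div : Expr → Expr → Expr
  | mod : Expr → Expr → Expr
  | lt : Expr → Expr → Expr
  | eq : Expr → Expr → Expr

/-- The value of an expression on a machine with words of `w` bits. Results are reduced modulo `2 ^ w`,
a negative difference is `0`, and comparisons give `1` or `0`. -/
def Expr.eval (w : ℕ) (r : ℕ → ℕ) : Expr → ℕ
  | .const k => k % 2 ^ w
  | .reg x => r x
  | .add a b => (a.eval w r + b.eval w r) % 2 ^ w
  | .sub a b => (a.eval w r - b.eval w r) % 2 ^ w
  | .mul a b => (a.eval w r * b.eval w r) % 2 ^ w
  | .div a b => (a.eval w r / b.eval w r) % 2 ^ w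
  | .mod a b => (a.eval w r % b.eval w r) % 2 ^ w
  | .lt a b => (if a.eval w r < b.eval w r then 1 else 0) % 2 ^ w
  | .eq a b => (if a.eval w r = b.eval w r then 1 else 0) % 2 ^ w

/-- The cost of evaluating an expression: the number of its constants, registers and operations. -/
def Expr.cost : Expr → ℕ
  | .const _ => 1
  | .reg _ => 1
  | .add a b => a.cost + b.cost + 1
  | .sub a b => a.cost + b.cost + 1
  | .mul a b => a.cost + b.cost + 1
  | .div a b => a.cost + b.cost + 1
  | .mod a b => a.cost + b.cost + 1
  | .lt a b => a.cost + b.cost + 1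
  | .eq a b => a.cost + b.cost + 1

/-- Programs. -/
inductive Program where
  /-- no operation -/
  | skip : Program
  /-- `x := e` for a register `x` -/
  | assign (x : ℕ) (e : Expr) : Program
  /-- `x := A[e]` for a register `x` and an array `A` -/
  | load (x A : ℕ) (e : Expr) : Program
  /-- `A[e] := f` for an array `A` -/
  | store (A : ℕ) (e f : Expr) : Program
  | seq (P Q : Program) : Program
  /-- if `e ≠ 0` then `P` else `Q` -/
  | cond (e : Expr) (P Q : Program) : Program
  /-- while `e ≠ 0` do `P` -/
  | loop (e : Expr) (P : Program) : Program

/-- The contents of the registers and of the arrays. -/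
structure State where
  reg : ℕ → ℕ
  arr : ℕ → ℕ → ℕ

/-- `Exec w M P s s' t`: with words of `w` bits and arrays of `M` cells, the program `P`, started in `s`,
halts in `s'` after `t` steps. -/
inductive Exec (w M : ℕ) : Program → State → State → ℕ → Prop where
  | skip (s : State) : Exec w M .skip s s 1
  | assign (x : ℕ) (e : Expr) (s : State) :
      Exec w M (.assign x e) s
        { s with reg := Function.update s.reg x (e.eval w s.reg) } (e.cost + 1)
  | load (x A : ℕ) (e : Expr) (s : State) (h : e.eval w s.reg < M) :
      Exec w M (.load x A e) s
        { s with reg := Function.update s.reg x (s.arr A (e.eval w s.reg)) } (e.cost + 1)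
  | store (A : ℕ) (e f : Expr) (s : State) (h : e.eval w s.reg < M) :
      Exec w M (.store A e f) s
        { s with
          arr := Function.update s.arr A
            (Function.update (s.arr A) (e.eval w s.reg) (f.eval w s.reg)) }
        (e.cost + f.cost + 1)
  | seq {P Q : Program} {s s' s'' : State} {t t' : ℕ}
      (hP : Exec w M P s s' t) (hQ : Exec w M Q s' s'' t') :
      Exec w M (.seq P Q) s s'' (t + t')
  | cond_true {e : Expr} {P Q : Program} {s s' : State} {t : ℕ}
      (h : e.eval w s.reg ≠ 0) (hP : Exec w M P s s' t) :
      Exec w M (.cond e P Q) s s' (e.cost + 1 + t)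
  | cond_false {e : Expr} {P Q : Program} {s s' : State} {t : ℕ}
      (h : e.eval w s.reg = 0) (hQ : Exec w M Q s s' t) :
      Exec w M (.cond e P Q) s s' (e.cost + 1 + t)
  | loop_true {e : Expr} {P : Program} {s s' s'' : State} {t t' : ℕ}
      (h : e.eval w s.reg ≠ 0) (hP : Exec w M P s s' t)
      (hL : Exec w M (.loop e P) s' s'' t') :
      Exec w M (.loop e P) s s'' (e.cost + 1 + t + t')
  | loop_false {e : Expr} {P : Program} {s : State} (h : e.eval w s.reg = 0) :
      Exec w M (.loop e P) s s (e.cost + 1)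

/-- The initial state for the input `S`: register `0` holds the length of `S`, array `0` holds `S`, and
everything else is `0`. -/
def input (S : List ℕ) : State where
  reg := fun x => if x = 0 then S.length else 0
  arr := fun A i => if A = 0 then S.getD i 0 else 0

end CartesianHeap

/-!
Nodes are prefixes of encoded suffixes, and everything rests on how an encoding changes when a
character is prepended. The new string starts with a `0`, and the first `q` zeros of the old encoding,
which stand at the strict prefix minima, become distances to the new front (`code_succ`); `q` is the
number of positions whose nearest smaller position is the new one. Hence a non-empty node arises from
an encoding that is shorter by one together with a number `q`; this is its reversed suffix link
(`Link`). The shorter encoding is again a node, and an older one (`exists_link`). It follows that the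
deepest node on the suffix of length `k + 1` is at most one deeper than the deepest node on the suffix
of length `k`, and that it is found by climbing from the latter towards the root until a link with
the required label exists (`runs_climb`). The depth pays for the climbs, which take `O(n)` searches for
links altogether.

This climb is used twice. In the first round, the deepest old node on a suffix is the parent of the
new node, and the place at which the last search failed is the one that has to take the link to the
new node (`runs_buildHeap`). In the second round, all links are present, and the climbs end at the
maximal reach pointers (`runs_computeReach`).

The label of a link is at most the number of zeros of its source, which is at most the number of
distinct characters (`count_zero_code_le`). The links of each node are kept in a digital search tree,
in which the search for `q` branches by the bits of `q`. Its depth is thus at most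
`1 + log₂ σ_S`, it needs no rebalancing, and all these trees together store each node once
(`IsDict.insert`).

The edges are sorted by going through the nodes by increasing labels of their edges, and appending each
edge to those with the same upper end (`runs_placeEdges`).

Running times are proved in a program logic whose assertions speak of the state and of a clock
(`Runs`); a bound on the clock is part of each loop invariant and makes the loop halt (`Runs.loop`).
-/

namespace CartesianHeap

/-! ### A program logic with a clock -/

/-- The value of an expression over unbounded natural numbers. -/
def Expr.val (r : ℕ → ℕ) : Expr → ℕ
  | .const k => k
  | .reg x => r x
  | .add a b => a.val r + b.val r
  | .sub a b => a.val r - b.val r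
  | .mul a b => a.val r * b.val r
  | .div a b => a.val r / b.val r
  | .mod a b => a.val r % b.val r
  | .lt a b => if a.val r < b.val r then 1 else 0
  | .eq a b => if a.val r = b.val r then 1 else 0

/-- No operation of the expression overflows if numbers have to be below `W`. -/
def Expr.Fits (W : ℕ) (r : ℕ → ℕ) : Expr → Prop
  | .const k => k < W
  | .reg _ => True
  | .add a b => a.Fits W r ∧ b.Fits W r ∧ a.val r + b.val r < W
  | .sub a b => a.Fits W r ∧ b.Fits W r ∧ a.val r - b.val r < W
  | .mul a b => a.Fits W r ∧ b.Fits W r ∧ a.val r * b.val r < W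
  | .div a b => a.Fits W r ∧ b.Fits W r ∧ a.val r / b.val r < W
  | .mod a b => a.Fits W r ∧ b.Fits W r ∧ a.val r % b.val r < W
  | .lt a b => a.Fits W r ∧ b.Fits W r ∧ 1 < W
  | .eq a b => a.Fits W r ∧ b.Fits W r ∧ 1 < W

theorem Expr.eval_eq_val {w : ℕ} {r : ℕ → ℕ} {e : Expr} (h : e.Fits (2 ^ w) r) :
    e.eval w r = e.val r := by
  induction e with
  | const k => exact Nat.mod_eq_of_lt h
  | reg x => rfl
  | add a b iha ihb | sub a b iha ihb | mul a b iha ihb | div a b iha ihb | mod a b iha ihb =>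
    simp only [Expr.eval, Expr.val, iha h.1, ihb h.2.1]
    exact Nat.mod_eq_of_lt h.2.2
  | lt a b iha ihb | eq a b iha ihb =>
    simp only [Expr.eval, Expr.val, iha h.1, ihb h.2.1]
    refine Nat.mod_eq_of_lt ?_
    have := h.2.2
    split_ifs <;> omega

/-- The registers that a program may change. -/
def Program.regs : Program → List ℕ
  | .skip => []
  | .assign x _ => [x]
  | .load x _ _ => [x]
  | .store _ _ _ => []
  | .seq P Q => P.regs ++ Q.regs
  | .cond _ P Q => P.regs ++ Q.regs
  | .loop _ P => P.regs

/-- The arrays that a program may change. -/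
def Program.arrs : Program → List ℕ
  | .skip => []
  | .assign _ _ => []
  | .load _ _ _ => []
  | .store A _ _ => [A]
  | .seq P Q => P.arrs ++ Q.arrs
  | .cond _ P Q => P.arrs ++ Q.arrs
  | .loop _ P => P.arrs

/-- The states differ only in registers and arrays that `P` may change. -/
def Frame (P : Program) (s s' : State) : Prop :=
  (∀ A, A ∉ P.arrs → s'.arr A = s.arr A) ∧ ∀ x, x ∉ P.regs → s'.reg x = s.reg x

theorem Frame.refl (P : Program) (s : State) : Frame P s s :=
  ⟨fun _ _ => rfl, fun _ _ => rfl⟩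

theorem Frame.trans {P : Program} {s s' s'' : State} (h : Frame P s s') (h' : Frame P s' s'') :
    Frame P s s'' :=
  ⟨fun A hA => (h'.1 A hA).trans (h.1 A hA), fun x hx => (h'.2 x hx).trans (h.2 x hx)⟩

theorem Frame.mono {P Q : Program} {s s' : State} (h : Frame P s s')
    (ha : P.arrs ⊆ Q.arrs) (hr : P.regs ⊆ Q.regs) : Frame Q s s' :=
  ⟨fun A hA => h.1 A fun h' => hA (ha h'), fun x hx => h.2 x fun h' => hx (hr h')⟩

theorem Exec.frame {w M : ℕ} {P : Program} {s s' : State} {t : ℕ} (h : Exec w M P s s' t) :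
    Frame P s s' := by
  induction h with
  | skip s => exact Frame.refl _ _
  | assign x e s =>
    refine ⟨fun _ _ => rfl, fun y hy => Function.update_of_ne ?_ _ _⟩
    simpa [Program.regs] using hy
  | load x A e s h =>
    refine ⟨fun _ _ => rfl, fun y hy => Function.update_of_ne ?_ _ _⟩
    simpa [Program.regs] using hy
  | store A e f s h =>
    refine ⟨fun y hy => Function.update_of_ne ?_ _ _, fun _ _ => rfl⟩
    simpa [Program.arrs] using hy
  | seq _ _ ihP ihQ =>
    exact (ihP.mono (List.subset_append_left _ _) (List.subset_append_left _ _)).trans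
      (ihQ.mono (List.subset_append_right _ _) (List.subset_append_right _ _))
  | cond_true _ _ ih => exact ih.mono (List.subset_append_left _ _) (List.subset_append_left _ _)
  | cond_false _ _ ih =>
    exact ih.mono (List.subset_append_right _ _) (List.subset_append_right _ _)
  | loop_true _ _ _ ih ih' => exact Frame.trans (P := .loop _ _) ih ih'
  | loop_false _ => exact Frame.refl _ _

/-- Started in `s` when the clock shows `τ`, the program halts, and the final state and the final time
satisfy `Q`. -/
def Runs (w M : ℕ) (P : Program) (s : State) (τ : ℕ) (Q : State → ℕ → Prop) : Prop :=
  ∃ s' t, Exec w M P s s' t ∧ Q s' (τ + t)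

section Rules

variable {w M : ℕ} {P P' : Program} {s : State} {τ : ℕ} {Q R : State → ℕ → Prop}

theorem Runs.mono (h : Runs w M P s τ R) (hQ : ∀ s' τ', Frame P s s' → R s' τ' → Q s' τ') :
    Runs w M P s τ Q := by
  obtain ⟨s', t, hE, hR⟩ := h
  exact ⟨s', t, hE, hQ _ _ hE.frame hR⟩

theorem Runs.seq (h : Runs w M P s τ fun s' τ' => Runs w M P' s' τ' Q) :
    Runs w M (.seq P P') s τ Q := by
  obtain ⟨s', t, hE, s'', t', hE', hQ⟩ := h
  exact ⟨s'', t + t', .seq hE hE', by rwa [← Nat.add_assoc]⟩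

/-- The rule for loops. Each turn takes time, so that a bound on the clock makes the loop halt. -/
theorem Runs.loop {e : Expr} {Inv : State → ℕ → Prop} (B : ℕ) (s : State) (τ : ℕ)
    (hB : ∀ s' τ', Inv s' τ' → τ' ≤ B)
    (hfit : ∀ s' τ', Inv s' τ' → Frame P s s' → e.Fits (2 ^ w) s'.reg)
    (hbody : ∀ s' τ', Inv s' τ' → Frame P s s' → e.val s'.reg ≠ 0 →
      Runs w M P s' (τ' + (e.cost + 1)) Inv)
    (hQ : ∀ s' τ', Inv s' τ' → Frame P s s' → e.val s'.reg = 0 → Q s' (τ' + (e.cost + 1)))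
    (h : Inv s τ) : Runs w M (.loop e P) s τ Q := by
  have key : ∀ d s' τ', B - τ' = d → Inv s' τ' → Frame P s s' →
      Runs w M (.loop e P) s' τ' Q := by
    intro d
    induction d using Nat.strong_induction_on with
    | _ d ih =>
      intro s' τ' hd hI hF
      have hev := Expr.eval_eq_val (hfit s' τ' hI hF)
      by_cases h0 : e.val s'.reg = 0
      · exact ⟨s', _, .loop_false (hev.trans h0), hQ _ _ hI hF h0⟩
      · obtain ⟨s₁, t₁, hE, hI₁⟩ := hbody s' τ' hI hF h0
        have := hB _ _ hI₁
        obtain ⟨s₂, t₂, hE₂, hQ₂⟩ := ih (B - (τ' + (e.cost + 1) + t₁)) (by omega) s₁ _ rfl hI₁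
          (hF.trans hE.frame)
        refine ⟨s₂, _, .loop_true (by rwa [hev]) hE hE₂, ?_⟩
        convert hQ₂ using 1
        omega
  exact key _ s τ rfl h (Frame.refl _ _)

end Rules

/-- A precondition under which `P` halts with `Q`. It is obtained by symbolic execution up to the
first loops, which are left as they are. -/
def wp (w M : ℕ) : Program → State → ℕ → (State → ℕ → Prop) → Prop
  | .skip, s, τ, Q => Q s (τ + 1)
  | .assign x e, s, τ, Q => e.Fits (2 ^ w) s.reg ∧
      Q ⟨Function.update s.reg x (e.val s.reg), s.arr⟩ (τ + (e.cost + 1))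
  | .load x A e, s, τ, Q => e.Fits (2 ^ w) s.reg ∧ e.val s.reg < M ∧
      Q ⟨Function.update s.reg x (s.arr A (e.val s.reg)), s.arr⟩ (τ + (e.cost + 1))
  | .store A e f, s, τ, Q => e.Fits (2 ^ w) s.reg ∧ f.Fits (2 ^ w) s.reg ∧ e.val s.reg < M ∧
      Q ⟨s.reg, Function.update s.arr A (Function.update (s.arr A) (e.val s.reg) (f.val s.reg))⟩
        (τ + (e.cost + f.cost + 1))
  | .seq P P', s, τ, Q => wp w M P s τ fun s' τ' => wp w M P' s' τ' Q
  | .cond e P P', s, τ, Q => e.Fits (2 ^ w) s.reg ∧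
      (e.val s.reg ≠ 0 → wp w M P s (τ + (e.cost + 1)) Q) ∧
      (e.val s.reg = 0 → wp w M P' s (τ + (e.cost + 1)) Q)
  | .loop e P, s, τ, Q => Runs w M (.loop e P) s τ Q

/-- Symbolic execution is sound. -/
theorem Runs.of_wp {w M : ℕ} {P : Program} {s : State} {τ : ℕ} {Q : State → ℕ → Prop}
    (h : wp w M P s τ Q) : Runs w M P s τ Q := by
  induction P generalizing s τ Q with
  | skip => exact ⟨s, 1, .skip s, h⟩
  | assign x e =>
    refine ⟨_, _, .assign x e s, ?_⟩
    rw [Expr.eval_eq_val h.1]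
    exact h.2
  | load x A e =>
    have hev := Expr.eval_eq_val h.1
    refine ⟨_, _, .load x A e s (by rw [hev]; exact h.2.1), ?_⟩
    rw [hev]
    exact h.2.2
  | store A e f =>
    have hev := Expr.eval_eq_val h.1
    refine ⟨_, _, .store A e f s (by rw [hev]; exact h.2.2.1), ?_⟩
    rw [hev, Expr.eval_eq_val h.2.1]
    exact h.2.2.2
  | seq P P' ih ih' => exact Runs.seq ((ih h).mono fun _ _ _ h' => ih' h')
  | cond e P P' ih ih' =>
    have hev := Expr.eval_eq_val h.1
    by_cases h0 : e.val s.reg = 0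
    · obtain ⟨s', t, hE, hQ⟩ := ih' (h.2.2 h0)
      exact ⟨s', _, .cond_false (hev.trans h0) hE, by rwa [← Nat.add_assoc]⟩
    · obtain ⟨s', t, hE, hQ⟩ := ih (h.2.1 h0)
      exact ⟨s', _, .cond_true (by rwa [hev]) hE, by rwa [← Nat.add_assoc]⟩
  | loop e P _ => exact h

/-! ### Prepending a character to an encoded string -/

/-- `fill q i l` replaces the first `q` zeros of `l` by their positions, where the head of `l` has the
position `i`. -/
def fill : ℕ → ℕ → List ℕ → List ℕ
  | _, _, [] => []
  | q, i, x :: l => if x = 0 ∧ 0 < q then i :: fill (q - 1) (i + 1) l else x :: fill q (i + 1) l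

@[simp] theorem fill_nil (q i : ℕ) : fill q i [] = [] := rfl

@[simp] theorem fill_zero (i : ℕ) (l : List ℕ) : fill 0 i l = l := by
  induction l generalizing i with
  | nil => rfl
  | cons x l ih => simp [fill, ih]

@[simp] theorem length_fill (q i : ℕ) (l : List ℕ) : (fill q i l).length = l.length := by
  induction l generalizing q i with
  | nil => rfl
  | cons x l ih => simp only [fill]; split_ifs <;> simp [ih]

theorem take_fill (q i m : ℕ) (l : List ℕ) : (fill q i l).take m = fill q i (l.take m) := by
  induction l generalizing q i m with
  | nil => simp
  | cons x l ih =>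
    cases m with
    | zero => simp
    | succ m => simp only [fill, List.take_succ_cons]; split_ifs <;> simp [ih]

theorem fill_min_count (q i : ℕ) (l : List ℕ) : fill (min q (l.count 0)) i l = fill q i l := by
  induction l generalizing q i with
  | nil => rfl
  | cons x l ih =>
    by_cases hx : x = 0
    · subst hx
      rcases Nat.eq_zero_or_pos q with rfl | hq
      · simp
      · have h1 : min q (l.count 0 + 1) - 1 = min (q - 1) (l.count 0) := by omega
        simp [fill, hq, h1, ih]
    · simp [fill, hx, ih]

/-- Filling can be undone if every entry is smaller than its position. -/
theorem fill_inj {q q' i : ℕ} {l l' : List ℕ} (hl : ∀ j (h : j < l.length), l[j] < i + j)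
    (hl' : ∀ j (h : j < l'.length), l'[j] < i + j) (h : fill q i l = fill q' i l') :
    l = l' ∧ min q (l.count 0) = min q' (l'.count 0) := by
  induction l generalizing q q' i l' with
  | nil =>
    have := congrArg List.length h
    simp at this
    have : l' = [] := List.length_eq_zero_iff.1 this.symm
    subst this
    simp
  | cons x l ih =>
    cases l' with
    | nil => have := congrArg List.length h; simp at this
    | cons x' l' =>
      have hx := hl 0 (by simp)
      have hx' := hl' 0 (by simp)
      simp only [List.getElem_cons_zero, Nat.add_zero] at hx hx'
      have ht : ∀ j (h : j < l.length), l[j] < i + 1 + j := fun j h => by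
        have := hl (j + 1) (by simpa using h)
        simp at this; omega
      have ht' : ∀ j (h : j < l'.length), l'[j] < i + 1 + j := fun j h => by
        have := hl' (j + 1) (by simpa using h)
        simp at this; omega
      simp only [fill] at h
      split_ifs at h with h1 h2 h2
      · obtain ⟨h3, h4⟩ := ih ht ht' (List.cons.inj h).2
        obtain ⟨rfl, h1⟩ := h1
        obtain ⟨rfl, h2⟩ := h2
        refine ⟨by rw [h3], ?_⟩
        simp only [List.count_cons_self]
        omega
      · have := (List.cons.inj h).1; omega
      · have := (List.cons.inj h).1; omega
      · obtain ⟨h3, h4⟩ := ih ht ht' (List.cons.inj h).2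
        obtain ⟨rfl, -⟩ := List.cons.inj h
        refine ⟨by rw [h3], ?_⟩
        by_cases hx0 : x = 0
        · have : q = 0 := by by_contra hq; exact h1 ⟨hx0, by omega⟩
          have : q' = 0 := by by_contra hq; exact h2 ⟨hx0, by omega⟩
          omega
        · simpa [List.count_cons, hx0] using h4

/-- If the filled positions are closed to the left among the zeros, they are the first zeros, and
filling depends on their number only. -/
theorem map_range_eq_fill (f : ℕ → ℕ) (c : ℕ → Prop) [DecidablePred c] (i k : ℕ)
    (hc : ∀ j j', j < j' → f j = 0 → f j' = 0 → c j' → c j) :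
    (List.range k).map (fun j => if f j = 0 ∧ c j then i + j else f j) =
      fill ((List.range k).countP fun j => f j = 0 ∧ c j) i ((List.range k).map f) := by
  induction k generalizing f c i with
  | zero => rfl
  | succ k ih =>
    have ih' := ih (fun j => f (j + 1)) (fun j => c (j + 1)) (i + 1)
      (fun j j' hj => hc (j + 1) (j' + 1) (by omega))
    simp only [List.range_succ_eq_map, List.map_cons, List.map_map, List.countP_cons,
      List.countP_map, fill, Function.comp_def, Nat.succ_eq_add_one, Nat.add_zero]
    have e : (fun j => if f (j + 1) = 0 ∧ c (j + 1) then i + (j + 1) else f (j + 1)) =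
        fun j => if f (j + 1) = 0 ∧ c (j + 1) then i + 1 + j else f (j + 1) := by
      funext j; rw [Nat.add_assoc i 1 j, Nat.add_comm 1 j]
    rw [e, ih']
    by_cases h0 : f 0 = 0
    · by_cases h1 : c 0
      · simp [h0, h1]
      · have : (List.range k).countP (fun j => f (j + 1) = 0 ∧ c (j + 1)) = 0 := by
          rw [List.countP_eq_zero]
          intro j _ hj
          simp only [decide_eq_true_eq] at hj
          exact h1 (hc 0 (j + 1) (by omega) h0 hj.1 hj.2)
        rw [this]
        simp [h0, h1]
    · simp [h0]

/-! ### Nearest smaller positions and encodings of suffixes -/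

/-- The nearest position on the left of `a` that holds a value at most that of `a`, and `0` if there is
none. Here positions start at `1`. -/
def prv (S : List ℕ) (a : ℕ) : ℕ :=
  Nat.findGreatest (fun j => 0 < j ∧ S.getD (j - 1) 0 ≤ S.getD (a - 1) 0) (a - 1)

theorem prv_lt (S : List ℕ) {a : ℕ} (ha : 0 < a) : prv S a < a := by
  have : prv S a ≤ a - 1 := Nat.findGreatest_le _
  omega

theorem prv_value_le (S : List ℕ) {a : ℕ} (h : prv S a ≠ 0) :
    S.getD (prv S a - 1) 0 ≤ S.getD (a - 1) 0 :=
  (Nat.findGreatest_of_ne_zero (P := fun j => 0 < j ∧ S.getD (j - 1) 0 ≤ S.getD (a - 1) 0) rfl h).2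

theorem value_lt_of_prv_lt (S : List ℕ) {a j : ℕ} (h : prv S a < j) (hj : j < a) :
    S.getD (a - 1) 0 < S.getD (j - 1) 0 := by
  have := Nat.findGreatest_is_greatest h (by omega : j ≤ a - 1)
  by_contra hc
  exact this ⟨by omega, by omega⟩

theorem prv_eq_of (S : List ℕ) {a j : ℕ} (hj : j < a)
    (h : j ≠ 0 → S.getD (j - 1) 0 ≤ S.getD (a - 1) 0)
    (h' : ∀ l, j < l → l < a → S.getD (a - 1) 0 < S.getD (l - 1) 0) : prv S a = j := by
  refine Nat.findGreatest_eq_iff.2 ⟨by omega, fun h0 => ⟨by omega, h h0⟩, fun l hl hl' hc => ?_⟩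
  have := h' l hl (by omega)
  omega

/-- The entry `i` of the encoding of the string that remains of `S` without its first `m`
characters. -/
def entry (S : List ℕ) (m i : ℕ) : ℕ :=
  if m < prv S (m + 1 + i) then m + 1 + i - prv S (m + 1 + i) else 0

theorem entry_le (S : List ℕ) (m i : ℕ) : entry S m i ≤ i := by
  unfold entry; split_ifs <;> omega

theorem parentDist_drop (S : List ℕ) (m : ℕ) (i : Fin (S.drop m).length) :
    parentDist (S.drop m) i = entry S m i := by
  have hi : (i : ℕ) < S.length - m := by simpa using i.2
  have hget : ∀ j : Fin (S.drop m).length, (S.drop m).get j = S.getD (m + j) 0 := by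
    intro j
    have hj : (j : ℕ) < S.length - m := by simpa using j.2
    have hj' : m + (j : ℕ) < S.length := by omega
    simp [hj']
  unfold parentDist entry
  split_ifs with h1 h2 h2
  · obtain ⟨b, hb⟩ : ∃ b, (leftLE (S.drop m) i).max' h1 = b := ⟨_, rfl⟩
    have hmem := (leftLE (S.drop m) i).max'_mem h1
    have hmax : ∀ x ∈ leftLE (S.drop m) i, x ≤ (leftLE (S.drop m) i).max' h1 :=
      fun x hx => (leftLE (S.drop m) i).le_max' x hx
    rw [hb] at hmem hmax ⊢
    simp only [leftLE, Finset.mem_filter, Finset.mem_univ, true_and, hget] at hmem hmax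
    have : prv S (m + 1 + i) = m + 1 + b := by
      refine prv_eq_of S ?_ ?_ ?_
      · have := hmem.1; simp only [Fin.lt_def] at this; omega
      · intro _
        rw [show m + 1 + (b : ℕ) - 1 = m + b by omega, show m + 1 + (i : ℕ) - 1 = m + i by omega]
        exact hmem.2
      · intro l hl hl'
        by_contra hc
        have := hmax ⟨l - m - 1, by simp; omega⟩ ⟨by simp only [Fin.lt_def]; omega, by
          rw [show m + (l - m - 1) = l - 1 by omega, show m + (i : ℕ) = m + 1 + i - 1 by omega]
          omega⟩
        simp only [Fin.le_def] at this
        omega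
    omega
  · exfalso
    obtain ⟨j, hj⟩ := h1
    simp only [leftLE, Finset.mem_filter, Finset.mem_univ, true_and, hget, Fin.lt_def] at hj
    have := value_lt_of_prv_lt S (a := m + 1 + i) (j := m + 1 + j) (by omega) (by omega)
    rw [show m + 1 + (j : ℕ) - 1 = m + j by omega, show m + 1 + (i : ℕ) - 1 = m + i by omega] at this
    omega
  · exfalso
    have hlt := prv_lt S (a := m + 1 + i) (by omega)
    have hle := prv_value_le S (a := m + 1 + i) (by omega)
    refine h1 ⟨⟨prv S (m + 1 + i) - (m + 1), by simp; omega⟩, ?_⟩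
    simp only [leftLE, Finset.mem_filter, Finset.mem_univ, true_and, hget, Fin.lt_def]
    refine ⟨by omega, ?_⟩
    rw [show m + (prv S (m + 1 + i) - (m + 1)) = prv S (m + 1 + i) - 1 by omega,
      show m + (i : ℕ) = m + 1 + i - 1 by omega]
    exact hle
  · rfl

theorem code_eq_map (S : List ℕ) {k : ℕ} (hk : k ≤ S.length) :
    code S k = (List.range k).map (entry S (S.length - k)) := by
  apply List.ext_getElem
  · simp [code, PD]; omega
  · intro i h1 h2
    simp [code, PD, parentDist_drop]

theorem length_code (S : List ℕ) {k : ℕ} (hk : k ≤ S.length) : (code S k).length = k := by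
  simp [code_eq_map S hk]

/-- The number of positions up to `i` whose nearest smaller position is `j`. -/
def indeg (S : List ℕ) (i j : ℕ) : ℕ :=
  (List.range i).countP fun a => prv S (a + 1) = j

/-- The number of zeros of `code S (k - 1)` that a prepended character turns into distances. -/
def reachCount (S : List ℕ) (k : ℕ) : ℕ :=
  indeg S S.length (S.length - k + 1)

theorem code_zero (S : List ℕ) : code S 0 = [] := by
  simp [code_eq_map S (Nat.zero_le _)]

/-- A prepended character fills the first zeros of the encoding. -/
theorem code_succ (S : List ℕ) {k : ℕ} (hk : k + 1 ≤ S.length) :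
    code S (k + 1) = 0 :: fill (reachCount S (k + 1)) 1 (code S k) := by
  obtain ⟨m, hm⟩ : ∃ m, S.length = m + 1 + k := ⟨S.length - (k + 1), by omega⟩
  rw [code_eq_map S hk, code_eq_map S (by omega), List.range_succ_eq_map, List.map_cons,
    List.map_map]
  have hm1 : S.length - (k + 1) = m := by omega
  have hm2 : S.length - k = m + 1 := by omega
  have h0 : entry S m 0 = 0 := Nat.le_zero.1 (entry_le S m 0)
  have hent : ∀ j, entry S (m + 1) j = 0 ↔ prv S (m + 2 + j) ≤ m + 1 := by
    intro j
    have := prv_lt S (a := m + 2 + j) (by omega)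
    unfold entry
    rw [show m + 1 + 1 + j = m + 2 + j by omega]
    split_ifs <;> omega
  have hmap := map_range_eq_fill (entry S (m + 1)) (fun j => prv S (m + 2 + j) = m + 1) 1 k (by
    intro j j' hj h h' hc
    rw [hent] at h
    rcases h.lt_or_eq with hlt | heq
    · exfalso
      have h1 := value_lt_of_prv_lt S (a := m + 2 + j) (j := m + 1) (by omega) (by omega)
      have h2 := value_lt_of_prv_lt S (a := m + 2 + j') (j := m + 2 + j) (by omega) (by omega)
      have h3 := prv_value_le S (a := m + 2 + j') (by omega)
      rw [hc] at h3
      omega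
    · exact heq)
  rw [hm1, hm2, h0]
  congr 1
  have hq : reachCount S (k + 1) =
      (List.range k).countP fun j => entry S (m + 1) j = 0 ∧ prv S (m + 2 + j) = m + 1 := by
    unfold reachCount indeg
    rw [hm, List.range_add, List.countP_append, List.countP_map]
    have h1 : (List.range (m + 1)).countP
        (fun a => prv S (a + 1) = m + 1 + k - (k + 1) + 1) = 0 := by
      rw [List.countP_eq_zero]
      intro a ha hc
      have := List.mem_range.1 ha
      have := prv_lt S (a := a + 1) (by omega)
      simp only [decide_eq_true_eq] at hc
      omega
    rw [h1, Nat.zero_add]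
    refine List.countP_congr fun j _ => ?_
    simp only [Function.comp_apply, decide_eq_true_eq, hent]
    rw [show m + 1 + j + 1 = m + 2 + j by omega, show m + 1 + k - (k + 1) + 1 = m + 1 by omega]
    omega
  rw [hq, ← hmap]
  refine List.map_congr_left fun j _ => ?_
  simp only [Function.comp_apply, hent]
  unfold entry
  rw [show m + 1 + j.succ = m + 2 + j by omega, show m + 1 + 1 + j = m + 2 + j by omega]
  split_ifs <;> omega

theorem entry_getElem_code_le (S : List ℕ) {k j : ℕ} (hk : k ≤ S.length)
    (h : j < (code S k).length) : (code S k)[j] ≤ j := by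
  simp [code_eq_map S hk, entry_le]

/-- The zeros of an encoding stand at the strict prefix minima, which hold distinct values. -/
theorem count_zero_code_le (S : List ℕ) {k : ℕ} (hk : k ≤ S.length) :
    (code S k).count 0 ≤ S.toFinset.card := by
  have h : (code S k).count 0 =
      ((Finset.range k).filter fun i => entry S (S.length - k) i = 0).card := by
    rw [code_eq_map S hk, List.count, List.countP_map, Finset.card_def, Finset.filter_val,
      Finset.range_val, Multiset.range, Multiset.filter_coe, Multiset.coe_card,
      List.countP_eq_length_filter]
    congr 1
  rw [h]
  have key : ∀ i i', i < i' → entry S (S.length - k) i' = 0 →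
      S.getD (S.length - k + i') 0 < S.getD (S.length - k + i) 0 := by
    intro i i' hi h0
    have hp := prv_lt S (a := S.length - k + 1 + i') (by omega)
    have := value_lt_of_prv_lt S (a := S.length - k + 1 + i') (j := S.length - k + 1 + i) (by
      unfold entry at h0; split_ifs at h0 <;> omega) (by omega)
    rwa [show S.length - k + 1 + i - 1 = S.length - k + i by omega,
      show S.length - k + 1 + i' - 1 = S.length - k + i' by omega] at this
  refine Finset.card_le_card_of_injOn (fun i => S.getD (S.length - k + i) 0) ?_ ?_
  · intro i hi
    simp only [Finset.coe_filter, Finset.mem_range, Set.mem_ofPred_eq] at hi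
    have : S.length - k + i < S.length := by omega
    simp [this]
  · intro i hi i' hi' he
    simp only [Finset.coe_filter, Finset.mem_range, Set.mem_ofPred_eq] at hi hi' he
    rcases lt_trichotomy i i' with h | h | h
    · have := key i i' h hi'.2; omega
    · exact h
    · have := key i' i h hi.2; omega

/-! ### The nodes of the heap -/

/-- The heap after the insertion of the suffixes of length at most `m`. -/
def partialHeap (S : List ℕ) (m : ℕ) : List (List ℕ) :=
  sht ((List.range m).map fun k => code S (k + 1))

theorem partialHeap_succ (S : List ℕ) (m : ℕ) : partialHeap S (m + 1) =
    partialHeap S m ++ [newNode (partialHeap S m) (code S (m + 1))] := by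
  simp [partialHeap, sht, List.range_succ]

theorem length_partialHeap (S : List ℕ) (m : ℕ) : (partialHeap S m).length = m + 1 := by
  induction m with
  | zero => rfl
  | succ m ih => simp [partialHeap_succ, ih]

theorem partialHeap_prefix (S : List ℕ) {m m' : ℕ} (h : m ≤ m') :
    partialHeap S m <+: partialHeap S m' := by
  induction h with
  | refl => exact List.prefix_refl _
  | step _ ih => exact ih.trans (by rw [partialHeap_succ]; exact List.prefix_append _ _)

theorem getElem_partialHeap (S : List ℕ) {m i : ℕ} (hm : m ≤ S.length)
    (hi : i < (partialHeap S m).length) : (partialHeap S m)[i] = node S i := by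
  have h := partialHeap_prefix S hm
  have hi' : i < (cph S).length := lt_of_lt_of_le hi h.length_le
  rw [node, List.getD_eq_getElem _ _ hi']
  exact h.getElem hi

theorem mem_partialHeap (S : List ℕ) {m : ℕ} (hm : m ≤ S.length) {x : List ℕ} :
    x ∈ partialHeap S m ↔ ∃ i ≤ m, node S i = x := by
  rw [List.mem_iff_getElem]
  constructor
  · rintro ⟨i, hi, rfl⟩
    exact ⟨i, by rw [length_partialHeap] at hi; omega, (getElem_partialHeap S hm hi).symm⟩
  · rintro ⟨i, hi, rfl⟩
    have hi' : i < (partialHeap S m).length := by rw [length_partialHeap]; omega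
    exact ⟨i, hi', getElem_partialHeap S hm hi'⟩

@[simp] theorem node_zero (S : List ℕ) : node S 0 = [] :=
  (getElem_partialHeap S (Nat.zero_le _) (i := 0) (by simp [length_partialHeap])).symm

theorem node_succ (S : List ℕ) {k : ℕ} (hk : k + 1 ≤ S.length) :
    node S (k + 1) = newNode (partialHeap S k) (code S (k + 1)) := by
  rw [← getElem_partialHeap S hk (by simp [length_partialHeap])]
  simp only [partialHeap_succ]
  rw [List.getElem_append_right (by simp [length_partialHeap])]
  simp [length_partialHeap]

/-- If `w` is not a node, then `newNode` finds a prefix, and its default value plays no role. -/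
theorem newNode_spec {α : Type*} [DecidableEq α] {T : List (List α)} {w : List α} (hw : w ∉ T) :
    newNode T w <+: w ∧ newNode T w ∉ T ∧
      ∀ m < (newNode T w).length, w.take m ∈ T := by
  unfold newNode
  cases h : w.inits.find? fun p => decide (p ∉ T) with
  | none =>
    have := List.find?_eq_none.1 h w ((List.mem_inits _ _).2 (List.prefix_refl _))
    simp at this
    exact absurd this hw
  | some x =>
    obtain ⟨hx, i, hi, rfl, hlt⟩ := List.find?_eq_some_iff_getElem.1 h
    simp only [List.getElem_inits, Option.getD_some, decide_eq_true_eq, Bool.not_eq_true',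
      decide_eq_false_iff_not, not_not] at hx hlt ⊢
    refine ⟨List.take_prefix _ _, hx, fun m hm => hlt m ?_⟩
    exact lt_of_lt_of_le hm (List.length_take_le _ _)

/-- The defining property of `node S k`, together with the bound on its depth by which the heap always
has room for the next suffix: a node of depth at most `k` cannot be `code S (k + 1)`. -/
theorem length_node_le_and_prefix (S : List ℕ) {k : ℕ} (hk : k ≤ S.length) :
    (node S k).length ≤ k ∧ node S k <+: code S k ∧ (∀ i < k, node S i ≠ node S k) ∧
      ∀ m < (node S k).length, ∃ i < k, node S i = (code S k).take m := by
  induction k using Nat.strong_induction_on with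
  | _ k ih =>
    rcases k with _ | k
    · simp
    · have hw : code S (k + 1) ∉ partialHeap S k := by
        rw [mem_partialHeap S (by omega)]
        rintro ⟨i, hi, h⟩
        have := (ih i (by omega) (by omega)).1
        rw [h, length_code S hk] at this
        omega
      obtain ⟨h1, h2, h3⟩ := newNode_spec hw
      rw [← node_succ S hk] at h1 h2 h3
      refine ⟨by have := h1.length_le; rwa [length_code S hk] at this, h1, ?_, ?_⟩
      · intro i hi h
        exact h2 ((mem_partialHeap S (by omega)).2 ⟨i, by omega, h⟩)
      · intro m hm
        obtain ⟨i, hi, h⟩ := (mem_partialHeap S (by omega)).1 (h3 m hm)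
        exact ⟨i, by omega, h⟩

theorem length_node_le (S : List ℕ) {k : ℕ} (hk : k ≤ S.length) : (node S k).length ≤ k :=
  (length_node_le_and_prefix S hk).1

theorem node_prefix_code (S : List ℕ) {k : ℕ} (hk : k ≤ S.length) : node S k <+: code S k :=
  (length_node_le_and_prefix S hk).2.1

theorem node_inj (S : List ℕ) {i j : ℕ} (hi : i ≤ S.length) (hj : j ≤ S.length)
    (h : node S i = node S j) : i = j := by
  rcases lt_trichotomy i j with hl | hl | hl
  · exact absurd h ((length_node_le_and_prefix S hj).2.2.1 i hl)
  · exact hl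
  · exact absurd h.symm ((length_node_le_and_prefix S hi).2.2.1 j hl)

theorem node_ne_nil (S : List ℕ) {k : ℕ} (hk : k ≤ S.length) (h0 : k ≠ 0) : node S k ≠ [] := by
  intro h
  exact h0 (node_inj S hk (Nat.zero_le _) (by simpa using h))

theorem exists_node_of_prefix (S : List ℕ) {k : ℕ} (hk : k ≤ S.length) {x : List ℕ}
    (hx : x <+: node S k) : ∃ i ≤ k, node S i = x := by
  rcases hx.length_le.lt_or_eq with hl | hl
  · obtain ⟨i, hi, h⟩ := (length_node_le_and_prefix S hk).2.2.2 _ hl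
    exact ⟨i, hi.le, h.trans (List.prefix_iff_eq_take.1 (hx.trans (node_prefix_code S hk))).symm⟩
  · exact ⟨k, le_rfl, (hx.eq_of_length hl).symm⟩

theorem count_zero_node_le (S : List ℕ) {k : ℕ} (hk : k ≤ S.length) :
    (node S k).count 0 ≤ S.toFinset.card :=
  ((node_prefix_code S hk).sublist.count_le _).trans (count_zero_code_le S hk)

theorem getElem_lt_of_prefix_code (S : List ℕ) {k : ℕ} (hk : k ≤ S.length) {x : List ℕ}
    (hx : x <+: code S k) (j : ℕ) (hj : j < x.length) : x[j] < 1 + j := by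
  have := entry_getElem_code_le S hk (lt_of_lt_of_le hj hx.length_le)
  rw [hx.getElem hj]
  omega

/-! ### Reversed suffix links -/

/-- `u` is reached from `v` by the reversed suffix link with label `q`: a character that is prepended
to a string with encoding `node S v`, and that fills `q` zeros, gives the encoding `node S u`. -/
def Link (S : List ℕ) (u v q : ℕ) : Prop :=
  node S u = 0 :: fill q 1 (node S v) ∧ q ≤ (node S v).count 0

/-- The label of the reversed suffix link that a prefix `node S v` of `code S (k - 1)` needs for the
step to `code S k`. -/
def linkLabel (S : List ℕ) (k v : ℕ) : ℕ :=
  min (reachCount S k) ((node S v).count 0)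

theorem linkLabel_le (S : List ℕ) (k v : ℕ) : linkLabel S k v ≤ (node S v).count 0 :=
  min_le_right _ _

theorem Link.length {S : List ℕ} {u v q : ℕ} (h : Link S u v q) :
    (node S u).length = (node S v).length + 1 := by
  rw [h.1]; simp

theorem Link.ne_zero {S : List ℕ} {u v q : ℕ} (h : Link S u v q) : u ≠ 0 := by
  rintro rfl
  simpa using h.length

theorem fill_eq_fill_of_prefix {S : List ℕ} {k k' q q' : ℕ} {x x' : List ℕ} (hk : k ≤ S.length)
    (hk' : k' ≤ S.length) (hx : x <+: code S k) (hx' : x' <+: code S k')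
    (h : 0 :: fill q 1 x = 0 :: fill q' 1 x') :
    x = x' ∧ min q (x.count 0) = min q' (x'.count 0) :=
  fill_inj (getElem_lt_of_prefix_code S hk hx) (getElem_lt_of_prefix_code S hk' hx')
    (List.cons.inj h).2

theorem Link.source_unique {S : List ℕ} {u v v' q q' : ℕ} (hv : v ≤ S.length) (hv' : v' ≤ S.length)
    (h : Link S u v q) (h' : Link S u v' q') : v = v' ∧ q = q' := by
  obtain ⟨h1, h2⟩ := fill_eq_fill_of_prefix hv hv' (node_prefix_code S hv) (node_prefix_code S hv')
    (h.1.symm.trans h'.1)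
  have := h.2
  have := h'.2
  exact ⟨node_inj S hv hv' h1, by omega⟩

/-- Filling commutes with taking prefixes. -/
theorem prefix_code_succ_iff {S : List ℕ} {k : ℕ} (hk : k + 1 ≤ S.length) {x : List ℕ}
    (hx : x ≠ []) : x <+: code S (k + 1) ↔
      ∃ y, y <+: code S k ∧ x = 0 :: fill (reachCount S (k + 1)) 1 y := by
  rw [code_succ S hk]
  constructor
  · intro h
    obtain ⟨a, x', rfl⟩ := List.exists_cons_of_ne_nil hx
    obtain ⟨rfl, h'⟩ := List.cons_prefix_cons.1 h
    refine ⟨(code S k).take x'.length, List.take_prefix _ _, ?_⟩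
    rw [← take_fill, ← List.prefix_iff_eq_take.1 h']
  · rintro ⟨y, hy, rfl⟩
    rw [List.cons_prefix_cons]
    refine ⟨rfl, ?_⟩
    rw [List.prefix_iff_eq_take.1 hy, ← take_fill]
    exact List.take_prefix _ _

theorem prefix_code_of_link {S : List ℕ} {k u v : ℕ} (hk : k + 1 ≤ S.length)
    (hv : node S v <+: code S k) (h : Link S u v (linkLabel S (k + 1) v)) :
    node S u <+: code S (k + 1) := by
  rw [prefix_code_succ_iff hk (by rw [h.1]; simp)]
  exact ⟨_, hv, by rw [h.1, linkLabel, fill_min_count]⟩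

theorem link_of_prefix_code {S : List ℕ} {k u v : ℕ} (hk : k + 1 ≤ S.length)
    (hv : node S v <+: code S k) (hu : node S u <+: code S (k + 1))
    (hl : (node S u).length = (node S v).length + 1) : Link S u v (linkLabel S (k + 1) v) := by
  obtain ⟨y, hy, h⟩ := (prefix_code_succ_iff hk (fun h => by simp [h] at hl)).1 hu
  have hy' : y = node S v := by
    rw [List.prefix_iff_eq_take.1 hy, List.prefix_iff_eq_take.1 hv]
    congr 1
    rw [h] at hl
    simpa using hl
  subst hy'
  exact ⟨by rw [h, linkLabel, fill_min_count], linkLabel_le _ _ _⟩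

/-- Every node but the root is the target of a reversed suffix link from an older node. -/
theorem exists_link (S : List ℕ) {k : ℕ} (hk : k ≤ S.length) (h0 : k ≠ 0) :
    ∃ j < k, ∃ q, Link S k j q := by
  induction k using Nat.strong_induction_on with
  | _ k ih =>
    obtain ⟨k, rfl⟩ := Nat.exists_eq_succ_of_ne_zero h0
    have hne := node_ne_nil S hk h0
    obtain ⟨x, hx, hnx⟩ := (prefix_code_succ_iff hk hne).1 (node_prefix_code S hk)
    suffices ∃ j ≤ k, node S j = x by
      obtain ⟨j, hj, rfl⟩ := this
      refine ⟨j, by omega, _, link_of_prefix_code hk hx (node_prefix_code S hk) ?_⟩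
      rw [Nat.succ_eq_add_one, hnx]; simp
    rcases x.eq_nil_or_concat' with rfl | ⟨y, c, rfl⟩
    · exact ⟨0, by omega, by simp⟩
    · -- The parent of the new node is the target of a link from `y`, so that `y` is an old node.
      have hy : y <+: code S k := (List.prefix_append _ _).trans hx
      have hp : 0 :: fill (reachCount S (k + 1)) 1 y <+: node S (k + 1) := by
        rw [Nat.succ_eq_add_one] at hnx
        rw [hnx, List.cons_prefix_cons]
        refine ⟨rfl, ?_⟩
        have : y = (y ++ [c]).take y.length := by simp
        conv_lhs => rw [this]
        rw [← take_fill]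
        exact List.take_prefix _ _
      obtain ⟨p, hpk, hpn⟩ := exists_node_of_prefix S hk hp
      have hpk' : p ≠ k + 1 := by
        rintro rfl
        rw [Nat.succ_eq_add_one] at hnx
        have := congrArg List.length (hpn.symm.trans hnx)
        simp at this
      have hp0 : p ≠ 0 := by rintro rfl; simp at hpn
      obtain ⟨j, hj, q, hl⟩ := ih p (by omega) (by omega) hp0
      have hjy := (fill_eq_fill_of_prefix (by omega) (by omega) (node_prefix_code S (by omega)) hy
        (hl.1.symm.trans hpn)).1
      -- So the node that the suffix of length `k` got is deeper than `y`.
      have hlen : (y ++ [c]).length ≤ (node S k).length := by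
        by_contra hc
        have hpre : node S k <+: node S j := by
          rw [hjy]
          exact List.prefix_of_prefix_length_le (node_prefix_code S (by omega)) hy
            (by simp at hc; omega)
        obtain ⟨i, hi, hin⟩ := exists_node_of_prefix S (by omega) hpre
        have := node_inj S (by omega) (by omega) hin
        omega
      exact exists_node_of_prefix S (by omega)
        (List.prefix_of_prefix_length_le hx (node_prefix_code S (by omega)) hlen)

/-! ### The deepest node on an encoded suffix -/

/-- Of the nodes with numbers below `N` that are prefixes of `code S k`, the deepest one is `j`. -/
def IsDeepest (S : List ℕ) (N k j : ℕ) : Prop :=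
  j < N ∧ node S j <+: code S k ∧
    ∀ i < N, node S i <+: code S k → (node S i).length ≤ (node S j).length

theorem IsDeepest.isMaxReach {S : List ℕ} {k j : ℕ} (h : IsDeepest S (S.length + 1) k j) :
    IsMaxReach S k j :=
  ⟨Nat.lt_succ_iff.1 h.1, h.2.1, fun i hi => h.2.2 i (Nat.lt_succ_iff.2 hi)⟩

theorem isDeepest_zero (S : List ℕ) {N : ℕ} (hN : 0 < N) : IsDeepest S N 0 0 :=
  ⟨hN, by simp, fun i _ hp => by simpa [code_zero] using hp.length_le⟩

theorem isDeepest_self (S : List ℕ) {k : ℕ} (hk : k ≤ S.length) : IsDeepest S (k + 1) k k := by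
  refine ⟨Nat.lt_succ_self k, node_prefix_code S hk, fun i hi hp => ?_⟩
  by_contra hc
  obtain ⟨j, hj, h⟩ := exists_node_of_prefix S (k := i) (by omega)
    (List.prefix_of_prefix_length_le (node_prefix_code S hk) hp (by omega))
  have := node_inj S (by omega) hk h
  obtain rfl : i = k := by omega
  omega

/-- One step along the suffixes increases the depth of the deepest node by at most `1`. -/
theorem IsDeepest.length_le_succ {S : List ℕ} {N k j : ℕ} (hN : N ≤ S.length + 1)
    (hk : k + 1 ≤ S.length) (h : IsDeepest S N k j) {i : ℕ} (hi : i < N)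
    (hp : node S i <+: code S (k + 1)) : (node S i).length ≤ (node S j).length + 1 := by
  rcases eq_or_ne i 0 with rfl | h0
  · simp
  obtain ⟨v, hv, q, hl⟩ := exists_link S (k := i) (by omega) h0
  obtain ⟨y, hy, hn⟩ := (prefix_code_succ_iff hk (node_ne_nil S (by omega) h0)).1 hp
  have hvy := (fill_eq_fill_of_prefix (by omega) (by omega) (node_prefix_code S (by omega)) hy
    (hl.1.symm.trans hn)).1
  have := h.2.2 v (by omega) (by rw [hvy]; exact hy)
  rw [hl.length]
  omega

/-- The new node is a child of the deepest old node on its suffix. -/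
theorem IsDeepest.node_eq {S : List ℕ} {k t : ℕ} (hk : k ≤ S.length) (h : IsDeepest S k k t) :
    node S k = node S t ++ [entry S (S.length - k) (node S t).length] := by
  have hpre := node_prefix_code S hk
  have hlt : (node S t).length < (node S k).length := by
    by_contra hc
    obtain ⟨i, hi, hn⟩ := exists_node_of_prefix S (k := t) (by have := h.1; omega)
      (List.prefix_of_prefix_length_le hpre h.2.1 (by omega))
    have := node_inj S (by have := h.1; omega) hk hn
    have := h.1
    omega
  have hle : (node S k).length ≤ (node S t).length + 1 := by
    obtain ⟨i, hi, hn⟩ := (length_node_le_and_prefix S hk).2.2.2 ((node S k).length - 1) (by omega)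
    have h1 := h.2.2 i hi (by rw [hn]; exact List.take_prefix _ _)
    have h2 := hpre.length_le
    rw [hn, List.length_take] at h1
    omega
  have hlen := hpre.length_le
  rw [length_code S hk] at hlen
  rw [List.prefix_iff_eq_take.1 hpre, show (node S k).length = (node S t).length + 1 by omega]
  have ht := List.prefix_iff_eq_take.1 h.2.1
  have hlt' : (node S t).length < k := by omega
  generalize (node S t).length = m at ht hlt'
  rw [ht, List.take_add_one]
  simp [code_eq_map S hk, hlt']

/-! ### Digital search trees for the reversed suffix links -/

/-- The search for the label `q` in the digital search tree of the node `v` visits after `i` steps the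
slot with the given number. A slot `r` contains the number `D r` of a node, or `0` if it is empty. The
root slot of the tree of `v` is `3 * v`, and the two slots below a stored node `t` are `3 * t + 1` and
`3 * t + 2`; each node is stored in the tree of the source of its reversed suffix link. The search
branches by the bits of `q`, the lowest one first. -/
inductive Walk (D key : ℕ → ℕ) (v q : ℕ) : ℕ → ℕ → Prop where
  | root : Walk D key v q 0 (3 * v)
  | down {i r : ℕ} (h : Walk D key v q i r) (h0 : D r ≠ 0) (hq : key (D r) ≠ q) :
      Walk D key v q (i + 1) (3 * D r + 1 + q / 2 ^ i % 2)

section Walk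

variable {D key : ℕ → ℕ} {v q : ℕ}

theorem Walk.eq {i r r' : ℕ} (h : Walk D key v q i r) (h' : Walk D key v q i r') : r = r' := by
  induction h generalizing r' with
  | root => cases h'; rfl
  | down _ _ _ ih =>
    cases h' with
    | down h1 _ _ => rw [ih h1]

theorem Walk.exists_of_lt {i j r : ℕ} (h : Walk D key v q j r) (hi : i < j) :
    ∃ r', Walk D key v q i r' ∧ D r' ≠ 0 ∧ key (D r') ≠ q := by
  induction h with
  | root => omega
  | @down j r h h0 hq ih =>
    rcases Nat.lt_succ_iff_lt_or_eq.1 hi with hl | rfl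
    · exact ih hl
    · exact ⟨r, h, h0, hq⟩

theorem Walk.le {i j r r' : ℕ} (h : Walk D key v q i r) (h' : Walk D key v q j r')
    (hs : D r' = 0 ∨ key (D r') = q) : i ≤ j := by
  by_contra hc
  obtain ⟨r'', h1, h2, h3⟩ := h.exists_of_lt (not_le.1 hc)
  rw [← h'.eq h1] at h2 h3
  tauto

theorem Walk.eq_of_ended {i j r r' : ℕ} (h : Walk D key v q i r) (h' : Walk D key v q j r')
    (hs : D r = 0 ∨ key (D r) = q) (hs' : D r' = 0 ∨ key (D r') = q) : r = r' := by
  obtain rfl : i = j := le_antisymm (h.le h' hs') (h'.le h hs)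
  exact h.eq h'

theorem Walk.slot_lt {N i r : ℕ} (hD : ∀ r, D r < N) (hv : v < N) (h : Walk D key v q i r) :
    r < 3 * N := by
  cases h with
  | root => omega
  | down h _ _ => have := hD ‹_›; omega

/-- A slot can be visited at one time only, in one tree only, and only by labels that agree in the
bits used so far. -/
theorem Walk.back {v' q' i i' r : ℕ} (hinj : ∀ r r', D r = D r' → D r ≠ 0 → r = r')
    (h : Walk D key v q i r) (h' : Walk D key v' q' i' r) :
    v = v' ∧ i = i' ∧ q % 2 ^ i = q' % 2 ^ i := by
  generalize hr : r = r₁ at h'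
  induction h generalizing i' r₁ with
  | root =>
    cases h' with
    | root => exact ⟨by omega, rfl, by simp [Nat.mod_one]⟩
    | down => omega
  | @down j s hw h0 hq ih =>
    cases h' with
    | root => omega
    | @down j' s' hw' h0' hq' =>
      have hs : s = s' := hinj _ _ (by omega) h0
      subst hs
      obtain ⟨h1, rfl, h3⟩ := ih _ rfl hw'
      refine ⟨h1, rfl, ?_⟩
      rw [Nat.mod_pow_succ, Nat.mod_pow_succ, h3, show q / 2 ^ j % 2 = q' / 2 ^ j % 2 by omega]

theorem Walk.update {N q₀ i r r₀ : ℕ} (hD : ∀ r, D r < N) (h0 : D r₀ = 0)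
    (h : Walk D key v q i r) :
    Walk (Function.update D r₀ N) (Function.update key N q₀) v q i r := by
  induction h with
  | root => exact .root
  | @down i r _ hr hq ih =>
    have hne : r ≠ r₀ := by rintro rfl; exact hr h0
    have hN : D r ≠ N := (hD r).ne
    have := ih.down (by simpa [hne] using hr) (by simpa [hne, hN] using hq)
    simpa [hne] using this

end Walk

/-- `D` and `key` store the reversed suffix links between the nodes with numbers below `N`, and every
search ends after at most `B` steps. -/
structure IsDict (S : List ℕ) (B N : ℕ) (D key : ℕ → ℕ) : Prop where
  lt : ∀ r, D r < N
  inj : ∀ r r', D r = D r' → D r ≠ 0 → r = r'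
  fresh : ∀ r, 3 * N ≤ r → D r = 0
  find : ∀ v < N, ∀ q ≤ (node S v).count 0, ∃ i ≤ B, ∃ r, Walk D key v q i r ∧
    ((D r = 0 ∧ ∀ u < N, ¬ Link S u v q) ∨ (D r ≠ 0 ∧ key (D r) = q ∧ Link S (D r) v q))

theorem isDict_one (S : List ℕ) (B : ℕ) (key : ℕ → ℕ) : IsDict S B 1 (fun _ => 0) key where
  lt _ := Nat.one_pos
  inj _ _ _ h := absurd rfl h
  fresh _ _ := rfl
  find v _ q _ := ⟨0, Nat.zero_le _, 3 * v, .root, .inl ⟨rfl, fun u hu h => by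
    have := h.ne_zero; omega⟩⟩

/-- The link to the new node is stored in the slot at which the search for its label has failed. Other
searches that end at this slot become longer by one step; the depth remains at most `B`, as labels
with the same lowest `B` bits are equal. -/
theorem IsDict.insert {S : List ℕ} {B N : ℕ} {D key : ℕ → ℕ} (hd : IsDict S B N D key)
    (hN : N ≤ S.length) (hB : ∀ v ≤ S.length, (node S v).count 0 < 2 ^ B)
    {p q i r : ℕ} (hp : p < N) (hl : Link S N p q) (hw : Walk D key p q i r) (hr : D r = 0) :
    IsDict S B (N + 1) (Function.update D r N) (Function.update key N q) := by
  have hr3 := hw.slot_lt hd.lt hp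
  refine ⟨fun r' => ?_, fun r₁ r₂ he h0 => ?_, fun r' hr' => ?_, fun v hv q' hq' => ?_⟩
  · rw [Function.update_apply]
    have := hd.lt r'
    split_ifs <;> omega
  · rw [Function.update_apply, Function.update_apply] at he
    rw [Function.update_apply] at h0
    have h1 := hd.lt r₁
    have h2 := hd.lt r₂
    split_ifs at he h0 with h3 h4 h4
    · omega
    · omega
    · omega
    · exact hd.inj _ _ he h0
  · rw [Function.update_of_ne (by omega)]
    exact hd.fresh r' (by omega)
  · rcases Nat.lt_succ_iff_lt_or_eq.1 hv with hvN | rfl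
    · obtain ⟨i', hi', r', hw', hs⟩ := hd.find v hvN q' hq'
      have hw'' := hw'.update (q₀ := q) hd.lt hr
      by_cases hrr : r' = r
      · subst hrr
        obtain ⟨rfl, rfl, hmod⟩ := hw'.back hd.inj hw
        have hno : ∀ u < N, ¬ Link S u v q' := by
          rcases hs with h | h
          · exact h.2
          · exact absurd hr h.1
        by_cases hqq : q' = q
        · subst hqq
          refine ⟨i', hi', r', hw'', .inr ?_⟩
          simp only [Function.update_self]
          exact ⟨by omega, trivial, hl⟩
        · -- The two labels differ, but not in the bits that led to the common slot.
          have hlt : i' < B := by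
            by_contra hc
            have hpow : 2 ^ B ≤ 2 ^ i' := Nat.pow_le_pow_right (by omega) (by omega)
            have h1 := hB v (by omega)
            have h2 := hl.2
            rw [Nat.mod_eq_of_lt (by omega), Nat.mod_eq_of_lt (by omega)] at hmod
            exact hqq hmod
          refine ⟨i' + 1, hlt, _, hw''.down ?_ ?_, .inl ⟨?_, fun u hu hlu => ?_⟩⟩
          · simp only [Function.update_self]; omega
          · simp only [Function.update_self]; omega
          · rw [Function.update_self, Function.update_of_ne (by omega)]
            exact hd.fresh _ (by omega)
          · rcases Nat.lt_succ_iff_lt_or_eq.1 hu with huN | rfl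
            · exact hno u huN hlu
            · exact hqq (hlu.source_unique (by omega) (by omega) hl).2
      · refine ⟨i', hi', r', hw'', ?_⟩
        rw [Function.update_of_ne hrr]
        rcases hs with ⟨h0, hno⟩ | ⟨h0, hk, hlk⟩
        · refine .inl ⟨h0, fun u hu hlu => ?_⟩
          rcases Nat.lt_succ_iff_lt_or_eq.1 hu with huN | rfl
          · exact hno u huN hlu
          · obtain ⟨rfl, rfl⟩ := hlu.source_unique (by omega) (by omega) hl
            exact hrr (hw'.eq_of_ended hw (.inl h0) (.inl hr))
        · have := hd.lt r'
          refine .inr ⟨h0, ?_, hlk⟩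
          rwa [Function.update_of_ne (by omega)]
    · refine ⟨0, Nat.zero_le _, 3 * v, .root, .inl ⟨?_, fun u hu hlu => ?_⟩⟩
      · rw [Function.update_of_ne (by omega)]
        exact hd.fresh _ le_rfl
      · obtain ⟨j, hj, q'', hl'⟩ := exists_link S (k := u) (by omega) hlu.ne_zero
        have := (hlu.source_unique (by omega) (by omega) hl').1
        omega

/-! ### The search for the deepest node on the next suffix

In all programs, register `0` contains the length `n` of the string, and register `1` a counter. The
nodes have the numbers `0, …, n`, and positions in the string start at `1`. Besides the input and the
output, the arrays contain

* `5` and `6`: for each position, the nearest smaller position, and the number of positions that have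
  it as their nearest smaller position;
* `7`, `8`, `9` and `10`: for each node, its parent, the label of the edge from the parent, its depth,
  and the number of its zeros;
* `11` and `12`: the label of the reversed suffix link to each node, and the slots of the digital search
  trees;
* `13` and `14`: for each edge label, the last node with this label, and for each node, the last node
  before it with the same label;
* `15`: for each node, the number of its edges that have been sorted in.
-/

/-- The size of the machine: the arrays have enough cells and the words enough bits for the numbers
that the programs below handle. -/
structure Fit (n w M : ℕ) : Prop where
  word : 4 * n + 8 ≤ 2 ^ w
  mem : 3 * n + 3 ≤ M

theorem Fit.ne_zero {n w M : ℕ} (h : Fit n w M) : w ≠ 0 := by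
  rintro rfl
  have := h.word
  omega

/-- Search for the label in register `4` in the digital search tree of the node in register `2`. The
search ends with the slot in register `6` and its content in register `7`. -/
def search : Program :=
  .seq (.assign 6 (.mul (.const 3) (.reg 2))) <|
  .seq (.assign 5 (.reg 4)) <|
  .seq (.load 7 12 (.reg 6)) <|
  .seq (.load 8 11 (.reg 7)) <|
  .loop (.mul (.reg 7) (.sub (.const 1) (.eq (.reg 8) (.reg 4)))) <|
    .seq (.assign 6 (.add (.add (.mul (.const 3) (.reg 7)) (.const 1))
      (.mod (.reg 5) (.const 2)))) <|
    .seq (.assign 5 (.div (.reg 5) (.const 2))) <|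
    .seq (.load 7 12 (.reg 6)) <|
    .load 8 11 (.reg 7)

/-- The search takes as many turns as the digital search tree has levels on its way, at most `B`. -/
theorem runs_search {S : List ℕ} {w M B N v q : ℕ} (hfit : Fit S.length w M) {s : State}
    (hN : N ≤ S.length + 1) (hd : IsDict S B N (s.arr 12) (s.arr 11)) (hv : v < N)
    (hq : q ≤ (node S v).count 0) (h2 : s.reg 2 = v) (h4 : s.reg 4 = q) (τ : ℕ) :
    Runs w M search s τ fun s' τ' => τ' ≤ τ + (40 * B + 40) ∧ ∃ i,
      Walk (s.arr 12) (s.arr 11) v q i (s'.reg 6) ∧ s'.reg 7 = s.arr 12 (s'.reg 6) ∧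
      ((s'.reg 7 = 0 ∧ ∀ u < N, ¬ Link S u v q) ∨ (s'.reg 7 ≠ 0 ∧ Link S (s'.reg 7) v q)) := by
  have hw0 := hfit.ne_zero
  obtain ⟨hW, hM⟩ := hfit
  have hqn : q ≤ S.length := by
    have := (node S v).count_le_length (a := 0)
    have := length_node_le S (k := v) (by omega)
    omega
  obtain ⟨m, hm, r, hwr, hr⟩ := hd.find v hv q hq
  have hend : s.arr 12 r = 0 ∨ s.arr 11 (s.arr 12 r) = q := by tauto
  have hlt := hd.lt
  refine Runs.of_wp ?_
  simp only [search, wp, Expr.val, Expr.Fits, Expr.cost]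
  have e1 := hlt (3 * v)
  simp [h2, h4]
  refine ⟨⟨by omega, by omega⟩, by omega, by omega, ?_⟩
  refine Runs.loop (Inv := fun s' τ' => ∃ i, Walk (s.arr 12) (s.arr 11) v q i (s'.reg 6) ∧
    s'.reg 7 = s.arr 12 (s'.reg 6) ∧ s'.reg 8 = s.arr 11 (s'.reg 7) ∧ s'.reg 5 = q / 2 ^ i ∧
    τ' ≤ τ + 20 + 40 * i) (τ + 20 + 40 * B) _ _ ?_ ?_ ?_ ?_ ?_
  · rintro s' τ' ⟨i, hw, -, -, -, ht⟩
    have := hw.le hwr hend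
    omega
  · rintro s' τ' ⟨i, hw, h7, h8, h5, ht⟩ -
    have := hlt (s'.reg 6)
    by_cases h84 : s'.reg 8 = s'.reg 4 <;> simp [Expr.Fits, Expr.val, h84] <;> omega
  · rintro s' τ' ⟨i, hw, h7, h8, h5, ht⟩ hF h0
    have h4' : s'.reg 4 = q := by rw [hF.2 4 (by decide)]; simpa using h4
    have ha : s'.arr = s.arr := funext fun A => hF.1 A (by simp [Program.arrs])
    have hq5 : q / 2 ^ i ≤ q := Nat.div_le_self _ _
    simp only [Expr.val, h4'] at h0
    have h0' : s'.reg 7 ≠ 0 ∧ s'.reg 8 ≠ q := by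
      split_ifs at h0 <;> simp_all
    have hnext := hw.down (by rw [← h7]; exact h0'.1) (by rw [← h7, ← h8]; exact h0'.2)
    rw [← h7, ← h5] at hnext
    have := hlt (s'.reg 6)
    have e2 := hlt (3 * s'.reg 7 + 1 + s'.reg 5 % 2)
    refine Runs.of_wp ?_
    simp only [wp, Expr.val, Expr.Fits, Expr.cost]
    simp [ha]
    refine ⟨by omega, by omega, by omega, by omega, i + 1, hnext, ?_, ?_⟩
    · rw [h5, Nat.div_div_eq_div_mul, pow_succ]
    · omega
  · rintro s' τ' ⟨i, hw, h7, h8, h5, ht⟩ hF h0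
    have h4' : s'.reg 4 = q := by rw [hF.2 4 (by decide)]; simpa using h4
    have hi := hw.le hwr hend
    simp only [Expr.val, h4', Expr.cost] at h0 ⊢
    have hs : s.arr 12 (s'.reg 6) = 0 ∨ s.arr 11 (s.arr 12 (s'.reg 6)) = q := by
      rw [← h7, ← h8]
      split_ifs at h0 <;> simp_all
    have := hw.eq_of_ended hwr hs hend
    refine ⟨by omega, ⟨i, hw⟩, h7, ?_⟩
    rw [h7, this]
    tauto
  · exact ⟨0, by simpa using Walk.root, by simp, by simp, by simp, by omega⟩

/-- Starting from the node in register `2`, climb towards the root until a node has a reversed suffix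
link for the next character; the number of the zeros which that character fills is in register `3`.
The target of the link is left in register `7`, and the slot and the label of the last search that
failed in the registers `10` and `11`. -/
def climb : Program :=
  .seq (.assign 9 (.const 1)) <|
  .loop (.reg 9) <|
    .seq (.seq (.load 4 10 (.reg 2)) (.cond (.lt (.reg 3) (.reg 4)) (.assign 4 (.reg 3)) .skip)) <|
    .seq search <|
    .cond (.reg 7) (.assign 9 (.const 0)) <|
      .seq (.assign 10 (.reg 6)) <|
      .seq (.assign 11 (.reg 4)) <|
      .cond (.reg 2) (.load 2 7 (.reg 2)) (.assign 9 (.const 0))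

/-- The time bound for a step of the climb if searches take at most `B` steps. -/
def climbCost (B : ℕ) : ℕ := 40 * B + 100

/-- The registers `10` and `11` describe a failed search for the link that leads from a node `p` of
depth `l` on the suffix of length `k` to the suffix of length `k + 1`. -/
def FailedAt (S : List ℕ) (N k l : ℕ) (D key : ℕ → ℕ) (slot q : ℕ) : Prop :=
  ∃ p < N, ∃ i, node S p <+: code S k ∧ (node S p).length = l ∧ q = linkLabel S (k + 1) p ∧
    Walk D key p q i slot ∧ D slot = 0

/-- The climb finds the deepest node on the next suffix. If the first search fails, then the last
failed one belongs to the node from which the link to a child of the deepest node has to start. Each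
step of the climb is paid for by the depth that it loses. -/
theorem runs_climb {S : List ℕ} {w M B N k v₀ : ℕ} (hfit : Fit S.length w M) {s : State}
    (hN : N ≤ S.length + 1) (hd : IsDict S B N (s.arr 12) (s.arr 11))
    (hpar : ∀ u < N, u ≠ 0 → s.arr 7 u < N ∧ ∃ c, node S u = node S (s.arr 7 u) ++ [c])
    (hz : ∀ u < N, s.arr 10 u = (node S u).count 0) (hk : k + 1 ≤ S.length)
    (hv : IsDeepest S N k v₀) (h2 : s.reg 2 = v₀) (h3 : s.reg 3 = reachCount S (k + 1)) (τ : ℕ) :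
    Runs w M climb s τ fun s' τ' => IsDeepest S N (k + 1) (s'.reg 7) ∧
      τ' + (node S (s'.reg 7)).length * climbCost B ≤
        τ + ((node S v₀).length + 2) * climbCost B + 10 ∧
      (Link S (s'.reg 7) v₀ (linkLabel S (k + 1) v₀) ∨
        FailedAt S N k (node S (s'.reg 7)).length (s.arr 12) (s.arr 11) (s'.reg 10) (s'.reg 11)) := by
  have hw0 := hfit.ne_zero
  have hW := hfit.word
  have hM := hfit.mem
  obtain ⟨X, hX⟩ : ∃ X, X = climbCost B := ⟨_, rfl⟩
  rw [← hX]
  rw [climbCost] at hX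
  refine Runs.of_wp ?_
  simp only [climb, wp, Expr.val, Expr.Fits, Expr.cost]
  refine ⟨by omega, Runs.loop (Inv := fun s' τ' =>
    (s'.reg 9 = 1 ∧ s'.reg 2 < N ∧ node S (s'.reg 2) <+: code S k ∧
      (∀ i < N, node S i <+: code S (k + 1) →
        (node S i).length ≤ (node S (s'.reg 2)).length + 1) ∧
      τ' + (node S (s'.reg 2)).length * X ≤ τ + (node S v₀).length * X + 2 ∧
      (s'.reg 2 = v₀ ∨ FailedAt S N k ((node S (s'.reg 2)).length + 1) (s.arr 12) (s.arr 11)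
        (s'.reg 10) (s'.reg 11))) ∨
    (s'.reg 9 = 0 ∧ IsDeepest S N (k + 1) (s'.reg 7) ∧
      τ' + (node S (s'.reg 7)).length * X ≤ τ + ((node S v₀).length + 2) * X + 2 ∧
      (Link S (s'.reg 7) v₀ (linkLabel S (k + 1) v₀) ∨
        FailedAt S N k (node S (s'.reg 7)).length (s.arr 12) (s.arr 11) (s'.reg 10)
          (s'.reg 11)))) (τ + ((node S v₀).length + 2) * X + 2) _ _ ?_ ?_ ?_ ?_ ?_⟩
  · rintro s' τ' (⟨-, -, -, -, h, -⟩ | ⟨-, -, h, -⟩)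
    · rw [Nat.add_mul]; omega
    · omega
  · intro s' τ' _ _; trivial
  · rintro s' τ' (⟨h9, hvN, hvk, hup, ht, hfail⟩ | ⟨h9, -⟩) hF h0
    · have ha : s'.arr = s.arr := funext fun A => hF.1 A (by simp [Program.arrs, search])
      have h3' : s'.reg 3 = reachCount S (k + 1) := by
        rw [hF.2 3 (by decide)]; simpa using h3
      obtain ⟨v, hv'⟩ : ∃ v, s'.reg 2 = v := ⟨_, rfl⟩
      rw [hv'] at hvN hvk hup ht hfail
      have hlab : Runs w M (.seq (.load 4 10 (.reg 2))
          (.cond (.lt (.reg 3) (.reg 4)) (.assign 4 (.reg 3)) .skip)) s'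
          (τ' + (Expr.cost (.reg 9) + 1)) fun s₁ τ₁ =>
            s₁.reg 4 = linkLabel S (k + 1) v ∧ τ₁ ≤ τ' + 20 := by
        refine Runs.of_wp ?_
        simp only [wp, Expr.val, Expr.Fits, Expr.cost]
        have e := hz v hvN
        simp [ha, hv', h3', e, linkLabel, hw0]
        omega
      refine Runs.seq (hlab.mono ?_)
      rintro s₁ τ₁ hF₁ ⟨h4, ht₁⟩
      have ha₁ : s₁.arr = s.arr := (funext fun A => hF₁.1 A (by simp [Program.arrs])).trans ha
      have h2₁ : s₁.reg 2 = v := (hF₁.2 2 (by decide)).trans hv'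
      refine Runs.seq ((runs_search hfit hN (by rw [ha₁]; exact hd) hvN (linkLabel_le S (k + 1) v)
        h2₁ h4 τ₁).mono ?_)
      rintro s₂ τ₂ hF₂ ⟨ht₂, i, hw, h7, hres⟩
      have ha₂ : s₂.arr = s.arr :=
        (funext fun A => hF₂.1 A (by simp [Program.arrs, search])).trans ha₁
      have h2₂ : s₂.reg 2 = v := (hF₂.2 2 (by decide)).trans h2₁
      have h4₂ : s₂.reg 4 = linkLabel S (k + 1) v := (hF₂.2 4 (by decide)).trans h4
      have h9₂ : s₂.reg 9 = 1 := by
        rw [hF₂.2 9 (by decide), hF₁.2 9 (by decide), h9]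
      rw [ha₁] at hw h7
      have hno : (∀ u < N, ¬ Link S u v (linkLabel S (k + 1) v)) → ∀ i < N,
          node S i <+: code S (k + 1) → (node S i).length ≤ (node S v).length := by
        intro h i hi hp
        by_contra hc
        have := hup i hi hp
        exact h i hi (link_of_prefix_code hk hvk hp (by omega))
      refine Runs.of_wp ?_
      simp only [wp, Expr.val, Expr.Fits, Expr.cost]
      refine ⟨trivial, fun h70 => ⟨by omega, .inr ?_⟩, fun h70 => ⟨trivial, trivial, trivial,
        fun h20 => ⟨trivial, ?_, .inl ?_⟩, fun h20 => ⟨by omega, .inr ?_⟩⟩⟩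
      · -- The search has found the link, and its target is the deepest node.
        have hl : Link S (s₂.reg 7) v (linkLabel S (k + 1) v) := by tauto
        simp only [Function.update_apply, Nat.reduceEqDiff, ↓reduceIte]
        have hlen := hl.length
        refine ⟨trivial, ⟨by rw [h7]; exact hd.lt _, prefix_code_of_link hk hvk hl,
          fun i hi hp => ?_⟩, ?_, ?_⟩
        · rw [hlen]; exact hup i hi hp
        · rw [hlen]; simp only [Nat.add_mul]; omega
        · rcases hfail with rfl | hfail
          · exact .inl hl
          · right
            have e₁₀ : s₂.reg 10 = s'.reg 10 := by rw [hF₂.2 10 (by decide), hF₁.2 10 (by decide)]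
            have e₁₁ : s₂.reg 11 = s'.reg 11 := by rw [hF₂.2 11 (by decide), hF₁.2 11 (by decide)]
            rwa [e₁₀, e₁₁, hlen]
      · simp only [Function.update_apply, Nat.reduceEqDiff, ↓reduceIte]
        omega
      · -- The search has failed, and the climb goes on from the parent.
        simp only [Function.update_apply, Nat.reduceEqDiff, ↓reduceIte] at h20 ⊢
        rw [h2₂, ha₂, h4₂, h9₂]
        rw [h2₂] at h20
        have hv1 : ∀ u < N, ¬ Link S u v (linkLabel S (k + 1) v) := by tauto
        obtain ⟨hpN, c, hpc⟩ := hpar v hvN h20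
        have hlen : (node S v).length = (node S (s.arr 7 v)).length + 1 := by rw [hpc]; simp
        refine ⟨rfl, hpN, ?_, ?_, ?_, .inr ?_⟩
        · exact List.IsPrefix.trans ⟨[c], hpc.symm⟩ hvk
        · rw [← hlen]; exact hno hv1
        · rw [hlen] at ht; simp only [Nat.add_mul] at ht ⊢; omega
        · exact ⟨v, hvN, i, hvk, hlen, rfl, hw, by rw [← h7]; exact h70⟩
      · -- The search has failed at the root.
        simp only [Function.update_apply, Nat.reduceEqDiff, ↓reduceIte] at h20 ⊢
        rw [h4₂]
        rw [h2₂] at h20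
        subst h20
        have hv1 : ∀ u < N, ¬ Link S u 0 (linkLabel S (k + 1) 0) := by tauto
        have h70' : s₂.reg 7 = 0 := h70
        rw [h70']
        refine ⟨trivial, ⟨hvN, by simp, hno hv1⟩, ?_, .inr ?_⟩
        · simp only [Nat.add_mul]; omega
        · exact ⟨0, hvN, i, hvk, rfl, rfl, hw, by rw [← h7]; exact h70⟩
    · simp [Expr.val, h9] at h0
  · rintro s' τ' (⟨h9, -⟩ | ⟨h9, h1, h2, h3⟩) hF h0
    · simp [Expr.val, h9] at h0
    · exact ⟨h1, by simp only [Expr.cost]; omega, h3⟩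
  · left
    simp only [Function.update_apply, Nat.reduceEqDiff, ↓reduceIte, h2]
    exact ⟨trivial, hv.1, hv.2.1, fun i hi hp => hv.length_le_succ hN hk hi hp, by omega, .inl trivial⟩

/-! ### The nearest smaller positions -/

/-- The number of positions on the way from `a` to the front by nearest smaller positions. -/
def chainLength (S : List ℕ) (a : ℕ) : ℕ :=
  if h : a = 0 then 0 else
    have := prv_lt S (Nat.pos_of_ne_zero h)
    chainLength S (prv S a) + 1

theorem chainLength_zero (S : List ℕ) : chainLength S 0 = 0 := by
  rw [chainLength]; simp

theorem chainLength_of_ne_zero (S : List ℕ) {a : ℕ} (h : a ≠ 0) :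
    chainLength S a = chainLength S (prv S a) + 1 := by
  rw [chainLength]; simp [h]

theorem indeg_succ (S : List ℕ) (i j : ℕ) :
    indeg S (i + 1) j = if prv S (i + 1) = j then indeg S i j + 1 else indeg S i j := by
  simp only [indeg, List.range_succ, List.countP_append, List.countP_singleton]
  split_ifs <;> simp_all

theorem indeg_le (S : List ℕ) (i j : ℕ) : indeg S i j ≤ i := by
  simpa [indeg] using List.countP_le_length (p := fun a => decide (prv S (a + 1) = j))
    (l := List.range i)

/-- Follow nearest smaller positions from the one in register `3` to the first one that holds a value
at most that in register `2`. -/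
def findSmaller : Program :=
  .loop (.mul (.reg 3) (.lt (.reg 2) (.reg 4))) <|
    .seq (.load 3 5 (.reg 3)) <|
    .load 4 0 (.sub (.reg 3) (.const 1))

/-- Compute `prv S` in array `5` and `indeg S S.length` in array `6`. -/
def computePrv : Program :=
  .loop (.lt (.reg 1) (.reg 0)) <|
    .seq (.seq (.assign 1 (.add (.reg 1) (.const 1))) <|
      .seq (.load 2 0 (.sub (.reg 1) (.const 1))) <|
      .seq (.assign 3 (.sub (.reg 1) (.const 1))) <|
      .load 4 0 (.sub (.reg 3) (.const 1))) <|
    .seq findSmaller <|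
    .seq (.store 5 (.reg 1) (.reg 3)) <|
    .seq (.load 4 6 (.reg 3)) <|
    .store 6 (.reg 3) (.add (.reg 4) (.const 1))

/-- The positions that are skipped on the way to `prv S (i + 1)` leave the chain of nearest smaller
positions, so that the length of the chain pays for them. -/
theorem runs_findSmaller {S : List ℕ} {w M i : ℕ} (hfit : Fit S.length w M) {s : State}
    (hi : i < S.length) (h0 : s.arr 0 = fun i => S.getD i 0)
    (h5 : ∀ a, 1 ≤ a → a ≤ i → s.arr 5 a = prv S a) (h2 : s.reg 2 = S.getD i 0)
    (h3 : s.reg 3 = i) (h4 : s.reg 4 = S.getD (i - 1) 0) (τ : ℕ) :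
    Runs w M findSmaller s τ fun s' τ' => s'.reg 3 = prv S (i + 1) ∧
      τ' + 20 * chainLength S (i + 1) ≤ τ + 20 * chainLength S i + 40 := by
  have hw0 := hfit.ne_zero
  have hW := hfit.word
  have hM := hfit.mem
  refine Runs.loop (Inv := fun s' τ' => s'.reg 3 ≤ i ∧ s'.reg 4 = S.getD (s'.reg 3 - 1) 0 ∧
    (∀ l, s'.reg 3 < l → l < i + 1 → S.getD i 0 < S.getD (l - 1) 0) ∧
    τ' + 20 * chainLength S (s'.reg 3) ≤ τ + 20 * chainLength S i)
    (τ + 20 * chainLength S i) _ _ ?_ ?_ ?_ ?_ ?_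
  · rintro s' τ' ⟨-, -, -, h⟩; omega
  · rintro s' τ' ⟨h, -, -, -⟩ -
    by_cases hc : s'.reg 2 < s'.reg 4 <;> simp [Expr.Fits, Expr.val, hc, hw0]
    omega
  · rintro s' τ' ⟨hji, h4', hl, ht⟩ hF hne
    have h2' : s'.reg 2 = S.getD i 0 := (hF.2 2 (by decide)).trans h2
    have ha : s'.arr = s.arr := funext fun A => hF.1 A (by simp [Program.arrs])
    obtain ⟨j, hj⟩ : ∃ j, s'.reg 3 = j := ⟨_, rfl⟩
    simp only [Expr.val, h2', h4', hj] at hne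
    rw [hj] at hji hl ht
    have hj0 : j ≠ 0 := by rintro rfl; simp at hne
    have hlt : S.getD i 0 < S.getD (j - 1) 0 := by
      by_contra hc; simp only [hc, ↓reduceIte, Nat.mul_zero, ne_eq, not_true_eq_false] at hne
    have hp := prv_lt S (a := j) (by omega)
    have hch := chainLength_of_ne_zero S hj0
    refine Runs.of_wp ?_
    simp only [wp, Expr.val, Expr.Fits, Expr.cost, Function.update_apply, Nat.reduceEqDiff,
      ↓reduceIte, ha, hj, h5 j (by omega) hji, h0]
    refine ⟨trivial, by omega, ⟨trivial, by omega, by omega⟩, by omega, by omega, trivial, ?_,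
      by omega⟩
    intro l hl1 hl2
    rcases lt_trichotomy l j with h | rfl | h
    · exact hlt.trans (value_lt_of_prv_lt S hl1 h)
    · exact hlt
    · exact hl l h hl2
  · rintro s' τ' ⟨hji, h4', hl, ht⟩ hF he
    have h2' : s'.reg 2 = S.getD i 0 := (hF.2 2 (by decide)).trans h2
    obtain ⟨j, hj⟩ : ∃ j, s'.reg 3 = j := ⟨_, rfl⟩
    simp only [Expr.val, h2', h4', hj] at he
    rw [hj] at hji hl ht
    have hp : prv S (i + 1) = j := by
      refine prv_eq_of S (by omega) (fun hj0 => ?_) hl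
      by_contra hc
      simp only [Nat.add_sub_cancel] at hc
      rw [if_pos (not_le.1 hc)] at he
      omega
    rw [hj]
    refine ⟨hp.symm, ?_⟩
    rw [chainLength_of_ne_zero S (Nat.succ_ne_zero i), hp]
    simp only [Expr.cost]
    omega
  · rw [h3]
    exact ⟨le_rfl, h4, fun l hl hl' => by omega, le_rfl⟩

theorem runs_computePrv {S : List ℕ} {w M : ℕ} (hfit : Fit S.length w M) {s : State}
    (hr0 : s.reg 0 = S.length) (hr1 : s.reg 1 = 0) (h0 : s.arr 0 = fun i => S.getD i 0)
    (h6 : s.arr 6 = fun _ => 0) (τ : ℕ) :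
    Runs w M computePrv s τ fun s' τ' => (∀ a, 1 ≤ a → a ≤ S.length → s'.arr 5 a = prv S a) ∧
      s'.arr 6 = indeg S S.length ∧ τ' ≤ τ + 120 * S.length + 10 := by
  have hw0 := hfit.ne_zero
  have hW := hfit.word
  have hM := hfit.mem
  refine Runs.loop (Inv := fun s' τ' => s'.reg 1 ≤ S.length ∧
    (∀ a, 1 ≤ a → a ≤ s'.reg 1 → s'.arr 5 a = prv S a) ∧ s'.arr 6 = indeg S (s'.reg 1) ∧
    τ' + 20 * chainLength S (s'.reg 1) ≤ τ + 120 * s'.reg 1) (τ + 120 * S.length) _ _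
    ?_ ?_ ?_ ?_ ?_
  · rintro s' τ' ⟨_, _, _, _⟩; omega
  · rintro s' τ' - -
    simp [Expr.Fits, hw0]
  · rintro s' τ' ⟨hin, h5', h6', ht⟩ hF hne
    have hr0' : s'.reg 0 = S.length := (hF.2 0 (by decide)).trans hr0
    have h0' : s'.arr 0 = fun i => S.getD i 0 := (hF.1 0 (by decide)).trans h0
    obtain ⟨i, hi⟩ : ∃ i, s'.reg 1 = i := ⟨_, rfl⟩
    rw [hi] at hin h5' h6' ht
    have hilt : i < S.length := by
      simp only [Expr.val, hi, hr0'] at hne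
      by_contra hc; simp [hc] at hne
    refine Runs.seq (Runs.of_wp ?_)
    simp only [wp, Expr.val, Expr.Fits, Expr.cost, Function.update_apply, Nat.reduceEqDiff,
      ↓reduceIte, h0', hi, Nat.add_sub_cancel]
    refine ⟨⟨trivial, by omega, by omega⟩, ⟨trivial, by omega, by omega⟩, by omega,
      ⟨trivial, by omega, by omega⟩, ⟨trivial, by omega, by omega⟩, by omega, ?_⟩
    refine Runs.seq ((runs_findSmaller hfit hilt ?_ ?_ ?_ ?_ ?_ _).mono ?_)
    · exact h0'
    · exact h5'
    · simp
    · simp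
    · simp
    rintro s₁ τ₁ hF₁ ⟨h3, ht₁⟩
    have hr1 : s₁.reg 1 = i + 1 := by
      rw [hF₁.2 1 (by decide)]; simp
    have ha : s₁.arr = s'.arr := funext fun A => hF₁.1 A (by simp [Program.arrs, findSmaller])
    have hp := prv_lt S (a := i + 1) (by omega)
    have hind := indeg_le S i (prv S (i + 1))
    refine Runs.of_wp ?_
    simp only [wp, Expr.val, Expr.Fits, Expr.cost, Function.update_apply, Nat.reduceEqDiff,
      ↓reduceIte, ha, h3, hr1, h6']
    refine ⟨trivial, trivial, by omega, trivial, by omega, trivial, ⟨trivial, by omega, by omega⟩,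
      by omega, by omega, ?_, ?_, by omega⟩
    · intro a ha1 ha2
      split_ifs with h
      · rw [h]
      · exact h5' a ha1 (by omega)
    · funext j
      rw [indeg_succ, Function.update_apply]
      rcases eq_or_ne (prv S (i + 1)) j with h | h
      · rw [if_pos h.symm, if_pos h, h]
      · rw [if_neg h.symm, if_neg h]
  · rintro s' τ' ⟨hin, h5', h6', ht⟩ hF he
    have hr0' : s'.reg 0 = S.length := (hF.2 0 (by decide)).trans hr0
    have : s'.reg 1 = S.length := by
      simp only [Expr.val, hr0'] at he
      by_contra hc
      rw [if_pos (by omega)] at he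
      omega
    rw [this] at h5' h6' ht
    refine ⟨h5', h6', ?_⟩
    simp only [Expr.cost]; omega
  · rw [hr1, chainLength_zero]
    refine ⟨Nat.zero_le _, fun a _ _ => by omega, ?_, by omega⟩
    rw [h6]; funext j; simp [indeg]

/-! ### Parents, edge labels and buckets -/

/-- The number of the parent of the node `u`. -/
noncomputable def parent (S : List ℕ) (u : ℕ) : ℕ :=
  sInf {p | node S p = (node S u).dropLast}

/-- The label of the edge from the parent of the node `u` to `u`. -/
def edgeLabel (S : List ℕ) (u : ℕ) : ℕ :=
  (node S u).getLast?.getD 0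

theorem node_eq_parent_append (S : List ℕ) {u : ℕ} (hu : u ≤ S.length) (h0 : u ≠ 0) :
    parent S u < u ∧ node S u = node S (parent S u) ++ [edgeLabel S u] := by
  have hne := node_ne_nil S hu h0
  obtain ⟨p, hp, hn⟩ := exists_node_of_prefix S hu (List.dropLast_prefix (node S u))
  have hmem : node S (parent S u) = (node S u).dropLast :=
    Nat.sInf_mem (s := {p | node S p = (node S u).dropLast}) ⟨p, hn⟩
  have hle : parent S u ≤ p := Nat.sInf_le (s := {p | node S p = (node S u).dropLast}) hn
  refine ⟨lt_of_le_of_ne (hle.trans hp) fun h => ?_, ?_⟩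
  · rw [h] at hmem
    have := congrArg List.length hmem
    have := List.length_pos_iff.2 hne
    simp at *
    omega
  · rw [hmem, edgeLabel, List.getLast?_eq_some_getLast hne]
    exact (List.dropLast_append_getLast hne).symm

theorem parent_eq (S : List ℕ) {u p c : ℕ} (hu : u ≤ S.length) (hp : p ≤ S.length)
    (h : node S u = node S p ++ [c]) : parent S u = p ∧ edgeLabel S u = c := by
  have h0 : u ≠ 0 := by rintro rfl; simp at h
  obtain ⟨h1, h2⟩ := node_eq_parent_append S hu h0
  rw [h2] at h
  obtain ⟨h3, h4⟩ := List.append_inj' h rfl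
  exact ⟨node_inj S (by omega) hp h3, by simpa using h4⟩

theorem edgeLabel_lt (S : List ℕ) {u : ℕ} (hu : u ≤ S.length) (h0 : u ≠ 0) :
    edgeLabel S u < u := by
  have h1 := (node_eq_parent_append S hu h0).2
  have h2 := getElem_lt_of_prefix_code S hu (node_prefix_code S hu) (node S (parent S u)).length
    (by rw [h1]; simp)
  have h3 := length_node_le S hu
  have h4 : (node S u).length = (node S (parent S u)).length + 1 := by conv_lhs => rw [h1]; simp
  have h5 : (node S u)[(node S (parent S u)).length]'(by omega) = edgeLabel S u := by
    rw [List.getElem_of_eq h1]; simp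
  omega

theorem isEdge_iff (S : List ℕ) {p c k : ℕ} : IsEdge S p c k ↔
    k ≤ S.length ∧ k ≠ 0 ∧ parent S k = p ∧ edgeLabel S k = c := by
  constructor
  · rintro ⟨hp, hk, h⟩
    refine ⟨hk, ?_, parent_eq S hk hp h⟩
    rintro rfl
    simp at h
  · rintro ⟨hk, h0, rfl, rfl⟩
    obtain ⟨h1, h2⟩ := node_eq_parent_append S hk h0
    exact ⟨by omega, hk, h2⟩

/-- The last of the nodes `u₁, …, uₘ` whose edges from their parents have the label `c`, and `0` if
there is none. -/
def lastWith (S : List ℕ) (c m : ℕ) : ℕ :=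
  Nat.findGreatest (fun u => u ≠ 0 ∧ edgeLabel S u = c) m

/-- The nodes with numbers below `N` whose parent is `p`. -/
noncomputable def children (S : List ℕ) (N p : ℕ) : Finset ℕ :=
  (Finset.range N).filter fun u => u ≠ 0 ∧ parent S u = p

/-- The rule by which a bucket list grows at its head. -/
theorem lastWith_succ (S : List ℕ) (c m : ℕ) :
    lastWith S c (m + 1) = if edgeLabel S (m + 1) = c then m + 1 else lastWith S c m := by
  simp [lastWith, Nat.findGreatest_succ]

theorem card_children_succ (S : List ℕ) {m p : ℕ} :
    (children S (m + 2) p).card =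
      if parent S (m + 1) = p then (children S (m + 1) p).card + 1
      else (children S (m + 1) p).card := by
  rw [children, Finset.range_add_one, Finset.filter_insert]
  by_cases h : parent S (m + 1) = p <;> simp [h, children]

theorem card_children_le (S : List ℕ) (N p : ℕ) : (children S N p).card ≤ N := by
  simpa [children] using Finset.card_filter_le (Finset.range N) fun u => u ≠ 0 ∧ parent S u = p

/-! ### The construction of the heap -/

/-- The arrays represent the heap with the nodes whose numbers are below `N`. -/
structure Represents (S : List ℕ) (B N : ℕ) (arr : ℕ → ℕ → ℕ) : Prop where
  parent : ∀ u < N, u ≠ 0 → arr 7 u = parent S u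
  label : ∀ u < N, u ≠ 0 → arr 8 u = edgeLabel S u
  depth : ∀ u < N, arr 9 u = (node S u).length
  zeros : ∀ u < N, arr 10 u = (node S u).count 0
  dict : IsDict S B N (arr 12) (arr 11)
  head : ∀ c, arr 13 c = lastWith S c (N - 1)
  next : ∀ u < N, u ≠ 0 → arr 14 u = lastWith S (edgeLabel S u) (u - 1)
  first_zero : arr 1 0 = 0
  first_succ : ∀ p, arr 1 (p + 1) = (children S N p).card

/-- Go on to the next suffix, whose length is put into register `1` and whose first position into
register `12`, and find the deepest node on it. -/
def nextSuffix : Program :=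
  .seq (.seq (.assign 1 (.add (.reg 1) (.const 1))) <|
    .seq (.assign 12 (.add (.sub (.reg 0) (.reg 1)) (.const 1))) <|
    .load 3 6 (.reg 12))
  climb

/-- Compute the label of the edge from the node in register `7` to the new node in register `16`, and
the number of zeros of the new node in register `15`. -/
def newLabel : Program :=
  .seq (.load 13 9 (.reg 7)) <|
  .seq (.load 14 5 (.add (.reg 12) (.reg 13))) <|
  .seq (.load 15 10 (.reg 7)) <|
  .cond (.lt (.reg 14) (.reg 12))
    (.seq (.assign 16 (.const 0)) (.assign 15 (.add (.reg 15) (.const 1))))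
    (.assign 16 (.sub (.add (.reg 12) (.reg 13)) (.reg 14)))

/-- Store the new node. -/
def storeNode : Program :=
  .seq (.store 12 (.reg 10) (.reg 1)) <|
  .seq (.store 11 (.reg 1) (.reg 11)) <|
  .seq (.store 7 (.reg 1) (.reg 7)) <|
  .seq (.store 9 (.reg 1) (.add (.reg 13) (.const 1))) <|
  .seq (.store 10 (.reg 1) (.reg 15)) <|
  .seq (.store 8 (.reg 1) (.reg 16)) <|
  .seq (.load 17 13 (.reg 16)) <|
  .seq (.store 14 (.reg 1) (.reg 17)) <|
  .seq (.store 13 (.reg 16) (.reg 1)) <|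
  .seq (.load 17 1 (.add (.reg 7) (.const 1))) <|
  .store 1 (.add (.reg 7) (.const 1)) (.add (.reg 17) (.const 1))

/-- Insert the nodes of the heap. -/
def buildHeap : Program :=
  .loop (.lt (.reg 1) (.reg 0)) <|
    .seq (.assign 2 (.reg 1)) <|
    .seq nextSuffix <|
    .seq newLabel storeNode

theorem runs_nextSuffix {S : List ℕ} {w M B N k v : ℕ} (hfit : Fit S.length w M) {s : State}
    (hN : N ≤ S.length + 1) (hh : Represents S B N s.arr) (h6 : s.arr 6 = indeg S S.length)
    (hk : k + 1 ≤ S.length) (hv : IsDeepest S N k v) (h0 : s.reg 0 = S.length) (h1 : s.reg 1 = k)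
    (h2 : s.reg 2 = v) (τ : ℕ) :
    Runs w M nextSuffix s τ fun s' τ' => s'.reg 1 = k + 1 ∧ s'.reg 12 = S.length - k ∧
      IsDeepest S N (k + 1) (s'.reg 7) ∧
      τ' + (node S (s'.reg 7)).length * climbCost B ≤
        τ + ((node S v).length + 2) * climbCost B + 30 ∧
      (Link S (s'.reg 7) v (linkLabel S (k + 1) v) ∨
        FailedAt S N k (node S (s'.reg 7)).length (s.arr 12) (s.arr 11) (s'.reg 10) (s'.reg 11)) := by
  have hw0 := hfit.ne_zero
  have hW := hfit.word
  have hM := hfit.mem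
  refine Runs.seq (Runs.of_wp ?_)
  simp only [wp, Expr.val, Expr.Fits, Expr.cost, Function.update_apply, Nat.reduceEqDiff,
    ↓reduceIte, h0, h1]
  refine ⟨⟨trivial, by omega, by omega⟩, ⟨⟨trivial, trivial, by omega⟩, by omega, by omega⟩,
    trivial, by omega, ?_⟩
  refine (runs_climb (B := B) (N := N) (k := k) (v₀ := v) hfit hN ?_ ?_ ?_ hk hv ?_ ?_ _).mono ?_
  · exact hh.dict
  · intro u hu hu0
    obtain ⟨h3, h4⟩ := node_eq_parent_append S (u := u) (by omega) hu0
    simp only [hh.parent u hu hu0]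
    exact ⟨by omega, _, h4⟩
  · exact hh.zeros
  · simpa using h2
  · simp [h6, reachCount]
  · rintro s' τ' hF ⟨h3, h4, h5⟩
    refine ⟨?_, ?_, h3, by omega, h5⟩
    · rw [hF.2 1 (by decide)]; simp
    · rw [hF.2 12 (by decide)]; simp; omega

theorem runs_newLabel {S : List ℕ} {w M B k t : ℕ} (hfit : Fit S.length w M) {s : State}
    (hh : Represents S B (k + 1) s.arr) (hk : k + 1 ≤ S.length)
    (h5 : ∀ a, 1 ≤ a → a ≤ S.length → s.arr 5 a = prv S a) (ht : IsDeepest S (k + 1) (k + 1) t)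
    (h7 : s.reg 7 = t) (h12 : s.reg 12 = S.length - k) (τ : ℕ) :
    Runs w M newLabel s τ fun s' τ' => s'.reg 13 = (node S t).length ∧
      s'.reg 15 = (node S (k + 1)).count 0 ∧ s'.reg 16 = edgeLabel S (k + 1) ∧ τ' ≤ τ + 40 := by
  have hw0 := hfit.ne_zero
  have hW := hfit.word
  have hM := hfit.mem
  have htk := ht.1
  have hlen := length_node_le S (k := t) (by omega)
  have hz := (node S t).count_le_length (a := 0)
  have hnode := ht.node_eq hk
  have hpe := (parent_eq S hk (by omega) hnode).2
  have hp5 := h5 (S.length - k + (node S t).length) (by omega) (by omega)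
  have hplt := prv_lt S (a := S.length - k + (node S t).length) (by omega)
  rw [hnode, hpe]
  unfold entry
  rw [show S.length - (k + 1) + 1 + (node S t).length = S.length - k + (node S t).length by omega]
  generalize prv S (S.length - k + (node S t).length) = b at *
  refine Runs.of_wp ?_
  simp only [newLabel, wp, Expr.val, Expr.Fits, Expr.cost, Function.update_apply, Nat.reduceEqDiff,
    ↓reduceIte, h7, h12, hh.depth t htk, hh.zeros t htk, hp5]
  refine ⟨trivial, by omega, ⟨trivial, trivial, by omega⟩, by omega, trivial, by omega,
    ⟨trivial, trivial, by omega⟩, fun hc => ?_, fun hc => ?_⟩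
  · have hb : ¬ S.length - (k + 1) < b := by
      intro h; rw [if_neg (by omega)] at hc; exact hc rfl
    rw [if_neg hb]
    refine ⟨by omega, ⟨trivial, by omega, by omega⟩, trivial, ?_, rfl, by omega⟩
    simp
  · have hb : S.length - (k + 1) < b := by
      by_contra h; rw [if_pos (by omega)] at hc; omega
    rw [if_pos hb]
    refine ⟨⟨⟨trivial, trivial, by omega⟩, trivial, by omega⟩, trivial, ?_, rfl, by omega⟩
    have : S.length - k + (node S t).length - b ≠ 0 := by omega
    simp [this]

theorem runs_storeNode {S : List ℕ} {w M B k t : ℕ} (hfit : Fit S.length w M) {s : State}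
    (hh : Represents S B (k + 1) s.arr) (hk : k + 1 ≤ S.length)
    (hB : ∀ v ≤ S.length, (node S v).count 0 < 2 ^ B) (ht : IsDeepest S (k + 1) (k + 1) t)
    (hf : FailedAt S (k + 1) k (node S t).length (s.arr 12) (s.arr 11) (s.reg 10) (s.reg 11))
    (h1 : s.reg 1 = k + 1) (h7 : s.reg 7 = t) (h13 : s.reg 13 = (node S t).length)
    (h15 : s.reg 15 = (node S (k + 1)).count 0) (h16 : s.reg 16 = edgeLabel S (k + 1)) (τ : ℕ) :
    Runs w M storeNode s τ fun s' τ' => Represents S B (k + 2) s'.arr ∧ τ' ≤ τ + 60 := by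
  have hw0 := hfit.ne_zero
  have hW := hfit.word
  have hM := hfit.mem
  have htk := ht.1
  have hlen := length_node_le S (k := t) (by omega)
  have hnode := ht.node_eq hk
  obtain ⟨hpar, -⟩ := parent_eq S hk (by omega) hnode
  have hlab := edgeLabel_lt S hk (by omega)
  have hch := card_children_le S (k + 1) t
  obtain ⟨p, hp, i, hpre, hpl, hq, hwalk, hD⟩ := hf
  have hlink : Link S (k + 1) p (s.reg 11) := by
    rw [hq]
    exact link_of_prefix_code hk hpre (node_prefix_code S hk) (by rw [hnode, hpl]; simp)
  have hslot := hwalk.slot_lt hh.dict.lt hp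
  refine Runs.of_wp ?_
  simp only [storeNode, wp, Expr.val, Expr.Fits, Expr.cost, Function.update_apply,
    Nat.reduceEqDiff, ↓reduceIte, h1, h7, h13, h15, h16, hh.first_succ]
  refine ⟨trivial, trivial, by omega, trivial, trivial, by omega, trivial, trivial, by omega,
    trivial, ⟨trivial, by omega, by omega⟩, by omega, trivial, trivial, by omega,
    trivial, trivial, by omega, trivial, by omega, trivial, trivial, by omega, trivial, trivial,
    by omega, ⟨trivial, by omega, by omega⟩, by omega, ⟨trivial, by omega, by omega⟩,
    ⟨trivial, by omega, by omega⟩, by omega, ?_, by omega⟩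
  constructor <;> simp only [Function.update_apply, Nat.reduceEqDiff, ↓reduceIte]
  · intro u hu h0
    split_ifs with h
    · rw [h, hpar]
    · exact hh.parent u (by omega) h0
  · intro u hu h0
    split_ifs with h
    · rw [h]
    · exact hh.label u (by omega) h0
  · intro u hu
    split_ifs with h
    · rw [h, hnode]; simp
    · exact hh.depth u (by omega)
  · intro u hu
    split_ifs with h
    · rw [h]
    · exact hh.zeros u (by omega)
  · exact hh.dict.insert hk hB hp hlink hwalk hD
  · intro c
    rw [show k + 2 - 1 = k + 1 by omega, lastWith_succ]
    rcases eq_or_ne (edgeLabel S (k + 1)) c with h | h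
    · rw [if_pos h, if_pos h.symm]
    · rw [if_neg h, if_neg h.symm]
      exact hh.head c
  · intro u hu h0
    split_ifs with h
    · rw [h]; exact hh.head _
    · exact hh.next u (by omega) h0
  · exact hh.first_zero
  · intro p'
    rw [card_children_succ, hpar]
    rcases eq_or_ne t p' with h | h
    · rw [if_pos h, if_pos (by omega), h]
    · rw [if_neg h, if_neg (by omega)]
      exact hh.first_succ p'

/-- The arrays represent the heap that consists of the root only. -/
theorem represents_one (S : List ℕ) (B : ℕ) {arr : ℕ → ℕ → ℕ}
    (h : ∀ A, A ∉ [0, 5, 6] → arr A = fun _ => 0) : Represents S B 1 arr where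
  parent u hu h0 := by omega
  label u hu h0 := by omega
  depth u hu := by
    obtain rfl : u = 0 := by omega
    simp [h 9 (by decide)]
  zeros u hu := by
    obtain rfl : u = 0 := by omega
    simp [h 10 (by decide)]
  dict := by rw [h 12 (by decide)]; exact isDict_one S B _
  head c := by simp [h 13 (by decide), lastWith]
  next u hu h0 := by omega
  first_zero := by simp [h 1 (by decide)]
  first_succ p := by
    have : children S 1 p = ∅ := Finset.filter_eq_empty_iff.2 fun u hu => by
      have := Finset.mem_range.1 hu; omega
    simp [h 1 (by decide), this]

/-- The depth of the last node is the potential: a new node is at most two levels deeper than the node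
at which its climb ends. -/
theorem runs_buildHeap {S : List ℕ} {w M B : ℕ} (hfit : Fit S.length w M)
    (hB : ∀ v ≤ S.length, (node S v).count 0 < 2 ^ B) {s : State}
    (hh : Represents S B 1 s.arr) (h5 : ∀ a, 1 ≤ a → a ≤ S.length → s.arr 5 a = prv S a)
    (h6 : s.arr 6 = indeg S S.length) (h0 : s.reg 0 = S.length) (h1 : s.reg 1 = 0) (τ : ℕ) :
    Runs w M buildHeap s τ fun s' τ' => Represents S B (S.length + 1) s'.arr ∧
      τ' ≤ τ + S.length * (3 * climbCost B + 150) + 10 := by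
  have hw0 := hfit.ne_zero
  have hW := hfit.word
  refine Runs.loop (Inv := fun s' τ' => s'.reg 1 ≤ S.length ∧
    Represents S B (s'.reg 1 + 1) s'.arr ∧ τ' + (node S (s'.reg 1)).length * climbCost B ≤
      τ + s'.reg 1 * (3 * climbCost B + 150)) (τ + S.length * (3 * climbCost B + 150)) _ _
    ?_ ?_ ?_ ?_ ?_
  · rintro s' τ' ⟨h, _, ht⟩
    have := Nat.mul_le_mul_right (3 * climbCost B + 150) h
    omega
  · rintro s' τ' - -
    simp [Expr.Fits, hw0]
  · rintro s' τ' ⟨hk, hh', ht⟩ hF hne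
    have h0' : s'.reg 0 = S.length := (hF.2 0 (by decide)).trans h0
    have h5' : s'.arr 5 = s.arr 5 := hF.1 5 (by decide)
    have h6' : s'.arr 6 = indeg S S.length := (hF.1 6 (by decide)).trans h6
    obtain ⟨k, hk'⟩ : ∃ k, s'.reg 1 = k := ⟨_, rfl⟩
    rw [hk'] at hk hh' ht
    have hkn : k + 1 ≤ S.length := by
      simp only [Expr.val, hk', h0'] at hne
      by_contra hc; rw [if_neg (by omega)] at hne; exact hne rfl
    refine Runs.seq (Runs.of_wp ⟨trivial, ?_⟩)
    refine Runs.seq ((runs_nextSuffix (B := B) (N := k + 1) (k := k) (v := k) hfit (by omega) ?_ ?_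
      hkn (isDeepest_self S hk) ?_ ?_ ?_ _).mono ?_)
    · exact hh'
    · exact h6'
    · simpa using h0'
    · simpa using hk'
    · simpa [Expr.val] using hk'
    rintro s₁ τ₁ hF₁ ⟨h1₁, h12₁, hd₁, ht₁, hl₁⟩
    have ha₁ : s₁.arr = s'.arr :=
      funext fun A => hF₁.1 A (by simp [Program.arrs, nextSuffix, climb, search])
    obtain ⟨t, h7₁⟩ : ∃ t, s₁.reg 7 = t := ⟨_, rfl⟩
    rw [h7₁] at hd₁ ht₁ hl₁
    -- The new node of the previous step has no reversed suffix link yet.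
    have hf : FailedAt S (k + 1) k (node S t).length (s'.arr 12) (s'.arr 11) (s₁.reg 10)
        (s₁.reg 11) := by
      refine hl₁.resolve_left fun hl => ?_
      have htk := hd₁.1
      obtain ⟨j, hj, q, hl'⟩ := exists_link S (k := t) (by omega) hl.ne_zero
      have := (hl.source_unique (by omega) (by omega) hl').1
      omega
    refine Runs.seq ((runs_newLabel (B := B) (k := k) (t := t) hfit (by rw [ha₁]; exact hh') hkn
      (by rw [ha₁, h5']; exact h5) hd₁ h7₁ h12₁ _).mono ?_)
    rintro s₂ τ₂ hF₂ ⟨h13₂, h15₂, h16₂, ht₂⟩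
    have ha₂ : s₂.arr = s₁.arr := funext fun A => hF₂.1 A (by simp [Program.arrs, newLabel])
    have hr : ∀ x, x ∉ newLabel.regs → s₂.reg x = s₁.reg x := hF₂.2
    refine (runs_storeNode (B := B) (k := k) (t := t) hfit (by rw [ha₂, ha₁]; exact hh') hkn hB hd₁
      ?_ ?_ ?_ h13₂ h15₂ h16₂ _).mono ?_
    · rw [ha₂, ha₁, hr 10 (by decide), hr 11 (by decide)]; exact hf
    · rw [hr 1 (by decide), h1₁]
    · rw [hr 7 (by decide), h7₁]
    rintro s₃ τ₃ hF₃ ⟨hh₃, ht₃⟩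
    have h1₃ : s₃.reg 1 = k + 1 := by rw [hF₃.2 1 (by decide), hr 1 (by decide), h1₁]
    rw [h1₃]
    refine ⟨hkn, hh₃, ?_⟩
    rw [hd₁.node_eq hkn]
    simp only [Expr.cost, List.length_append, List.length_singleton, Nat.add_mul] at *
    omega
  · rintro s' τ' ⟨hk, hh', ht⟩ hF he
    have h0' : s'.reg 0 = S.length := (hF.2 0 (by decide)).trans h0
    have : s'.reg 1 = S.length := by
      simp only [Expr.val, h0'] at he
      by_contra hc
      rw [if_pos (by omega)] at he
      omega
    rw [this] at hh' ht
    refine ⟨hh', ?_⟩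
    simp only [Expr.cost]; omega
  · rw [h1]
    exact ⟨Nat.zero_le _, hh, by simp⟩

/-! ### The maximal reach pointers -/

/-- Go through the suffixes once more, now with all links, and store the deepest nodes on them in
array `4`. -/
def computeReach : Program :=
  .loop (.lt (.reg 1) (.reg 0)) <|
    .seq nextSuffix <|
    .seq (.store 4 (.reg 1) (.reg 7)) (.assign 2 (.reg 7))

theorem runs_computeReach {S : List ℕ} {w M B : ℕ} (hfit : Fit S.length w M) {s : State}
    (hh : Represents S B (S.length + 1) s.arr) (h6 : s.arr 6 = indeg S S.length)
    (h0 : s.reg 0 = S.length) (h1 : s.reg 1 = 0) (h2 : s.reg 2 = 0) (τ : ℕ) :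
    Runs w M computeReach s τ fun s' τ' =>
      (∀ k, 1 ≤ k → k ≤ S.length → IsMaxReach S k (s'.arr 4 k)) ∧
      τ' ≤ τ + S.length * (2 * climbCost B + 80) + 10 := by
  have hw0 := hfit.ne_zero
  have hW := hfit.word
  have hM := hfit.mem
  refine Runs.loop (Inv := fun s' τ' => s'.reg 1 ≤ S.length ∧
    IsDeepest S (S.length + 1) (s'.reg 1) (s'.reg 2) ∧
    (∀ k, 1 ≤ k → k ≤ s'.reg 1 → IsMaxReach S k (s'.arr 4 k)) ∧
    τ' + (node S (s'.reg 2)).length * climbCost B ≤ τ + s'.reg 1 * (2 * climbCost B + 80))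
    (τ + S.length * (2 * climbCost B + 80)) _ _ ?_ ?_ ?_ ?_ ?_
  · rintro s' τ' ⟨h, _, _, ht⟩
    have := Nat.mul_le_mul_right (2 * climbCost B + 80) h
    omega
  · rintro s' τ' - -
    simp [Expr.Fits, hw0]
  · rintro s' τ' ⟨hk, hd, hm, ht⟩ hF hne
    have h0' : s'.reg 0 = S.length := (hF.2 0 (by decide)).trans h0
    have h6' : s'.arr 6 = indeg S S.length := (hF.1 6 (by decide)).trans h6
    have hh' : Represents S B (S.length + 1) s'.arr := by
      have e : ∀ A, A ≠ 4 → s'.arr A = s.arr A := fun A hA =>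
        hF.1 A (by simpa [Program.arrs, nextSuffix, climb, search] using hA)
      constructor <;> simp only [e 1, e 7, e 8, e 9, e 10, e 11, e 12, e 13, e 14, ne_eq,
        Nat.reduceEqDiff, OfNat.one_ne_ofNat, not_false_eq_true]
      exacts [hh.parent, hh.label, hh.depth, hh.zeros, hh.dict, hh.head, hh.next, hh.first_zero,
        hh.first_succ]
    obtain ⟨k, hk'⟩ : ∃ k, s'.reg 1 = k := ⟨_, rfl⟩
    rw [hk'] at hk hd hm ht
    have hkn : k + 1 ≤ S.length := by
      simp only [Expr.val, hk', h0'] at hne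
      by_contra hc; rw [if_neg (by omega)] at hne; exact hne rfl
    refine Runs.seq ((runs_nextSuffix hfit le_rfl hh' h6' hkn hd h0' hk' rfl _).mono ?_)
    rintro s₁ τ₁ hF₁ ⟨h1₁, -, hd₁, ht₁, -⟩
    have ha₁ : s₁.arr = s'.arr :=
      funext fun A => hF₁.1 A (by simp [Program.arrs, nextSuffix, climb, search])
    refine Runs.of_wp ?_
    simp only [wp, Expr.val, Expr.Fits, Expr.cost, Function.update_apply, Nat.reduceEqDiff,
      ↓reduceIte, h1₁, ha₁]
    refine ⟨trivial, trivial, by omega, trivial, hkn, hd₁, ?_, ?_⟩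
    · intro u hu hu'
      split_ifs with h
      · rw [h]; exact hd₁.isMaxReach
      · exact hm u hu (by omega)
    · simp only [Expr.cost, Nat.add_mul] at *
      omega
  · rintro s' τ' ⟨hk, hd, hm, ht⟩ hF he
    have h0' : s'.reg 0 = S.length := (hF.2 0 (by decide)).trans h0
    have : s'.reg 1 = S.length := by
      simp only [Expr.val, h0'] at he
      by_contra hc
      rw [if_pos (by omega)] at he
      omega
    rw [this] at hm ht
    refine ⟨hm, ?_⟩
    simp only [Expr.cost]; omega
  · rw [h1, h2]
    exact ⟨Nat.zero_le _, isDeepest_zero S (Nat.succ_pos _), fun k _ _ => by omega, by simp⟩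

/-! ### The positions of the edges in the sorted order -/

/-- The number of edges that leave nodes with numbers below `p`. -/
noncomputable def firstEdge (S : List ℕ) (p : ℕ) : ℕ :=
  ∑ i ∈ Finset.range p, (children S (S.length + 1) i).card

/-- The number of siblings of the node `u` whose edges have smaller labels. -/
noncomputable def rank (S : List ℕ) (u : ℕ) : ℕ :=
  ((children S (S.length + 1) (parent S u)).filter fun v => edgeLabel S v < edgeLabel S u).card

/-- The position of the edge to the node `u` in the order by parents and labels. -/
noncomputable def edgePos (S : List ℕ) (u : ℕ) : ℕ :=
  firstEdge S (parent S u) + rank S u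

theorem mem_children {S : List ℕ} {p u : ℕ} :
    u ∈ children S (S.length + 1) p ↔ u ≤ S.length ∧ u ≠ 0 ∧ parent S u = p := by
  simp [children]

theorem firstEdge_succ (S : List ℕ) (p : ℕ) :
    firstEdge S (p + 1) = firstEdge S p + (children S (S.length + 1) p).card :=
  Finset.sum_range_succ _ _

theorem firstEdge_mono (S : List ℕ) {p p' : ℕ} (h : p ≤ p') : firstEdge S p ≤ firstEdge S p' :=
  Finset.sum_le_sum_of_subset (Finset.range_mono h)

theorem firstEdge_last (S : List ℕ) : firstEdge S (S.length + 1) = S.length := by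
  have h := Finset.card_eq_sum_card_fiberwise (s := Finset.Icc 1 S.length)
    (t := Finset.range (S.length + 1)) (f := parent S) (by
      intro u hu
      have hu' := Finset.mem_Icc.1 hu
      have := (node_eq_parent_append S hu'.2 (by omega)).1
      exact Finset.mem_coe.2 (Finset.mem_range.2 (by omega)))
  rw [Nat.card_Icc] at h
  rw [firstEdge]
  refine Eq.trans (Finset.sum_congr rfl fun p _ => ?_) (h.symm.trans (by omega))
  congr 1
  ext u
  rw [mem_children, Finset.mem_filter, Finset.mem_Icc]
  omega

theorem eq_of_parent_of_edgeLabel {S : List ℕ} {u v : ℕ} (hu : u ≤ S.length) (hu0 : u ≠ 0)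
    (hv : v ≤ S.length) (hv0 : v ≠ 0) (hp : parent S u = parent S v)
    (hl : edgeLabel S u = edgeLabel S v) : u = v :=
  node_inj S hu hv (by
    rw [(node_eq_parent_append S hu hu0).2, (node_eq_parent_append S hv hv0).2, hp, hl])

theorem rank_lt_card (S : List ℕ) {u : ℕ} (hu : u ≤ S.length) (h0 : u ≠ 0) :
    rank S u < (children S (S.length + 1) (parent S u)).card :=
  Finset.card_lt_card (Finset.filter_ssubset.2 ⟨u, mem_children.2 ⟨hu, h0, rfl⟩, lt_irrefl _⟩)

theorem rank_lt_rank {S : List ℕ} {u v : ℕ} (hu : u ≤ S.length) (h0 : u ≠ 0)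
    (hp : parent S u = parent S v) (hl : edgeLabel S u < edgeLabel S v) : rank S u < rank S v := by
  refine Finset.card_lt_card ((Finset.ssubset_iff_of_subset fun x hx => ?_).2
    ⟨u, Finset.mem_filter.2 ⟨mem_children.2 ⟨hu, h0, hp⟩, hl⟩, fun h => ?_⟩)
  · rw [Finset.mem_filter] at hx ⊢
    exact ⟨hp ▸ hx.1, hx.2.trans hl⟩
  · exact lt_irrefl _ (Finset.mem_filter.1 h).2

theorem edgeLabel_lt_of_rank_lt {S : List ℕ} {u v : ℕ} (hv : v ≤ S.length) (hv0 : v ≠ 0)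
    (hu : u ≤ S.length) (hu0 : u ≠ 0)
    (hp : parent S u = parent S v) (h : rank S u < rank S v) : edgeLabel S u < edgeLabel S v := by
  by_contra hc
  rcases (not_lt.1 hc).lt_or_eq with hl | hl
  · have := rank_lt_rank hv hv0 hp.symm hl
    omega
  · have := eq_of_parent_of_edgeLabel hv hv0 hu hu0 hp.symm hl
    subst this
    exact lt_irrefl _ h

theorem rank_inj {S : List ℕ} {u v : ℕ} (hu : u ≤ S.length) (hu0 : u ≠ 0)
    (hv : v ≤ S.length) (hv0 : v ≠ 0) (hp : parent S u = parent S v) (h : rank S u = rank S v) :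
    u = v := by
  refine eq_of_parent_of_edgeLabel hu hu0 hv hv0 hp ?_
  by_contra hc
  rcases lt_or_gt_of_ne hc with hl | hl
  · have := rank_lt_rank hu hu0 hp hl; omega
  · have := rank_lt_rank hv hv0 hp.symm hl; omega

theorem edgePos_lt (S : List ℕ) {u : ℕ} (hu : u ≤ S.length) (h0 : u ≠ 0) :
    edgePos S u < firstEdge S (parent S u + 1) := by
  rw [firstEdge_succ, edgePos]
  have := rank_lt_card S hu h0
  omega

theorem edgePos_lt_length (S : List ℕ) {u : ℕ} (hu : u ≤ S.length) (h0 : u ≠ 0) :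
    edgePos S u < S.length := by
  have h1 := edgePos_lt S hu h0
  have h2 := (node_eq_parent_append S hu h0).1
  have h3 := firstEdge_mono S (show parent S u + 1 ≤ S.length + 1 by omega)
  rw [firstEdge_last] at h3
  omega

theorem edgePos_inj {S : List ℕ} {u v : ℕ} (hu : u ≤ S.length) (hu0 : u ≠ 0)
    (hv : v ≤ S.length) (hv0 : v ≠ 0) (h : edgePos S u = edgePos S v) : u = v := by
  have h1 := edgePos_lt S hu hu0
  have h2 := edgePos_lt S hv hv0
  rcases lt_trichotomy (parent S u) (parent S v) with hl | hp | hl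
  · have := firstEdge_mono S (show parent S u + 1 ≤ parent S v from hl)
    simp only [edgePos] at *
    omega
  · refine rank_inj hu hu0 hv hv0 hp ?_
    rw [edgePos, edgePos, hp] at h
    omega
  · have := firstEdge_mono S (show parent S v + 1 ≤ parent S u from hl)
    simp only [edgePos] at *
    omega

/-- By counting: the ranks of the children of `p` are distinct and below the number of these
children. -/
theorem exists_edgePos_eq (S : List ℕ) {p e : ℕ} (h1 : firstEdge S p ≤ e)
    (h2 : e < firstEdge S (p + 1)) :
    ∃ u ≤ S.length, u ≠ 0 ∧ parent S u = p ∧ edgePos S u = e := by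
  rw [firstEdge_succ] at h2
  have hsurj := Finset.surjOn_of_injOn_of_card_le (s := children S (S.length + 1) p)
    (t := Finset.range (children S (S.length + 1) p).card) (rank S) (by
      intro u hu
      obtain ⟨hu1, hu2, rfl⟩ := mem_children.1 (Finset.mem_coe.1 hu)
      exact Finset.mem_coe.2 (Finset.mem_range.2 (rank_lt_card S hu1 hu2))) (by
      intro u hu v hv h
      obtain ⟨hu1, hu2, hu3⟩ := mem_children.1 (Finset.mem_coe.1 hu)
      obtain ⟨hv1, hv2, hv3⟩ := mem_children.1 (Finset.mem_coe.1 hv)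
      exact rank_inj hu1 hu2 hv1 hv2 (hu3.trans hv3.symm) h) (by simp)
  obtain ⟨u, hu, hr⟩ := hsurj (show e - firstEdge S p ∈ _ from
    Finset.mem_coe.2 (Finset.mem_range.2 (by omega)))
  obtain ⟨hu1, hu2, rfl⟩ := mem_children.1 (Finset.mem_coe.1 hu)
  exact ⟨u, hu1, hu2, rfl, by rw [edgePos, hr]; omega⟩

theorem isSortedHeap_of_edgePos {S : List ℕ} {first label child mrp : ℕ → ℕ}
    (hf : ∀ p ≤ S.length + 1, first p = firstEdge S p)
    (he : ∀ u ≤ S.length, u ≠ 0 → label (edgePos S u) = edgeLabel S u ∧ child (edgePos S u) = u)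
    (hm : ∀ k, 1 ≤ k → k ≤ S.length → IsMaxReach S k (mrp k)) :
    IsSortedHeap S first label child mrp where
  first_zero := by rw [hf 0 (Nat.zero_le _)]; rfl
  first_last := by rw [hf _ le_rfl, firstEdge_last]
  first_le k hk := by
    rw [hf k (by omega), hf (k + 1) (by omega)]
    exact firstEdge_mono S (Nat.le_succ k)
  edges p hp c k := by
    rw [isEdge_iff, hf p (by omega), hf (p + 1) (by omega)]
    constructor
    · rintro ⟨hk, h0, rfl, rfl⟩
      exact ⟨edgePos S k, Nat.le_add_right _ _, edgePos_lt S hk h0, he k hk h0⟩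
    · rintro ⟨e, h1, h2, rfl, rfl⟩
      obtain ⟨u, hu, h0, hpu, rfl⟩ := exists_edgePos_eq S h1 h2
      obtain ⟨h3, h4⟩ := he u hu h0
      rw [h3, h4]
      exact ⟨hu, h0, hpu, rfl⟩
  sorted p hp e e' h1 h2 h3 := by
    rw [hf p (by omega)] at h1
    rw [hf (p + 1) (by omega)] at h3
    obtain ⟨u, hu, h0, hpu, rfl⟩ := exists_edgePos_eq S h1 (by omega)
    obtain ⟨v, hv, hv0, hpv, rfl⟩ := exists_edgePos_eq S (h1.trans h2.le) h3
    rw [(he u hu h0).1, (he v hv hv0).1]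
    refine edgeLabel_lt_of_rank_lt hv hv0 hu h0 (hpu.trans hpv.symm) ?_
    rw [edgePos, edgePos, hpu, hpv] at h2
    omega
  reach := hm

/-! ### Sorting the edges -/

/-- Replace the numbers of children in array `1` by their prefix sums. -/
def sumCounts : Program :=
  .loop (.lt (.reg 1) (.add (.reg 0) (.const 1))) <|
    .seq (.load 2 1 (.reg 1)) <|
    .seq (.assign 1 (.add (.reg 1) (.const 1))) <|
    .seq (.load 3 1 (.reg 1)) <|
    .store 1 (.reg 1) (.add (.reg 2) (.reg 3))

/-- Go through the nodes by increasing labels of their edges, and store the edge to each node behind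
the edges with the same upper end that have been stored before. Register `2` contains the label,
register `3` the node, and array `15` the numbers of edges stored so far. -/
def placeEdges : Program :=
  .loop (.lt (.reg 2) (.add (.reg 0) (.const 1))) <|
    .cond (.reg 3)
      (.seq (.load 4 7 (.reg 3)) <|
        .seq (.load 5 1 (.reg 4)) <|
        .seq (.load 6 15 (.reg 4)) <|
        .seq (.store 15 (.reg 4) (.add (.reg 6) (.const 1))) <|
        .seq (.assign 6 (.add (.reg 5) (.reg 6))) <|
        .seq (.store 2 (.reg 6) (.reg 2)) <|
        .seq (.store 3 (.reg 6) (.reg 3)) <|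
        .load 3 14 (.reg 3))
      (.seq (.assign 2 (.add (.reg 2) (.const 1))) <|
        .load 3 13 (.reg 2))

theorem runs_sumCounts {S : List ℕ} {w M : ℕ} (hfit : Fit S.length w M) {s : State}
    (h0 : s.reg 0 = S.length) (h1 : s.reg 1 = 0) (hz : s.arr 1 0 = 0)
    (hs : ∀ p, s.arr 1 (p + 1) = (children S (S.length + 1) p).card) (τ : ℕ) :
    Runs w M sumCounts s τ fun s' τ' => (∀ p ≤ S.length + 1, s'.arr 1 p = firstEdge S p) ∧
      τ' ≤ τ + 30 * (S.length + 1) + 10 := by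
  have hw0 := hfit.ne_zero
  have hW := hfit.word
  have hM := hfit.mem
  refine Runs.loop (Inv := fun s' τ' => s'.reg 1 ≤ S.length + 1 ∧
    (∀ p ≤ s'.reg 1, s'.arr 1 p = firstEdge S p) ∧
    (∀ p, s'.reg 1 ≤ p → s'.arr 1 (p + 1) = (children S (S.length + 1) p).card) ∧
    τ' ≤ τ + 30 * s'.reg 1) (τ + 30 * (S.length + 1)) _ _ ?_ ?_ ?_ ?_ ?_
  · rintro s' τ' ⟨_, _, _, _⟩; omega
  · rintro s' τ' - hF
    have h0' : s'.reg 0 = S.length := (hF.2 0 (by decide)).trans h0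
    simp [Expr.Fits, Expr.val, hw0, h0']
    omega
  · rintro s' τ' ⟨hi, hle, hge, ht⟩ hF hne
    have h0' : s'.reg 0 = S.length := (hF.2 0 (by decide)).trans h0
    obtain ⟨i, hi'⟩ : ∃ i, s'.reg 1 = i := ⟨_, rfl⟩
    rw [hi'] at hi hle hge ht
    have hin : i < S.length + 1 := by
      simp only [Expr.val, hi', h0'] at hne
      by_contra hc; rw [if_neg hc] at hne; exact hne rfl
    have e1 := hle i le_rfl
    have e2 := hge i le_rfl
    have e3 := firstEdge_succ S i
    have e4 := firstEdge_mono S (show i + 1 ≤ S.length + 1 by omega)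
    rw [firstEdge_last] at e4
    refine Runs.of_wp ?_
    simp only [wp, Expr.val, Expr.Fits, Expr.cost, Function.update_apply, Nat.reduceEqDiff,
      ↓reduceIte, hi', e1, e2]
    refine ⟨trivial, by omega, ⟨trivial, by omega, by omega⟩, trivial, by omega, trivial,
      ⟨trivial, trivial, by omega⟩, by omega, by omega, fun p hp => ?_, fun p hp => ?_, by omega⟩
    · split_ifs with h
      · rw [h, e3]
      · exact hle p (by omega)
    · rw [if_neg (by omega)]
      exact hge p (by omega)
  · rintro s' τ' ⟨hi, hle, hge, ht⟩ hF he
    have h0' : s'.reg 0 = S.length := (hF.2 0 (by decide)).trans h0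
    have : s'.reg 1 = S.length + 1 := by
      simp only [Expr.val, h0'] at he
      by_contra hc
      rw [if_pos (by omega)] at he
      omega
    rw [this] at hle ht
    refine ⟨hle, ?_⟩
    simp only [Expr.cost]; omega
  · rw [h1]
    refine ⟨Nat.zero_le _, fun p hp => ?_, fun p _ => hs p, by omega⟩
    obtain rfl : p = 0 := by omega
    rw [hz]; rfl

/-- The nodes whose edges have labels below `c`, or the label `c` and numbers above `m`. -/
def placed (S : List ℕ) (c m : ℕ) : Finset ℕ :=
  (Finset.Icc 1 S.length).filter fun u => edgeLabel S u < c ∨ edgeLabel S u = c ∧ m < u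

theorem card_placed_le (S : List ℕ) (c m : ℕ) : (placed S c m).card ≤ S.length := by
  simpa [placed] using Finset.card_filter_le (Finset.Icc 1 S.length)
    fun u => edgeLabel S u < c ∨ edgeLabel S u = c ∧ m < u

theorem lastWith_le (S : List ℕ) (c m : ℕ) : lastWith S c m ≤ m := Nat.findGreatest_le _

theorem edgeLabel_lastWith {S : List ℕ} {c m : ℕ} (h : lastWith S c m ≠ 0) :
    edgeLabel S (lastWith S c m) = c :=
  (Nat.findGreatest_of_ne_zero (P := fun u => u ≠ 0 ∧ edgeLabel S u = c) rfl h).2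

theorem le_lastWith {S : List ℕ} {c m u : ℕ} (hu : u ≤ m) (h0 : u ≠ 0) (h : edgeLabel S u = c) :
    u ≤ lastWith S c m :=
  Nat.le_findGreatest hu ⟨h0, h⟩

/-- The next entry of the list of nodes with label `c` comes after all nodes in `placed S c m`. -/
theorem placed_lastWith {S : List ℕ} {c m : ℕ} (hm : m ≤ S.length) (h : lastWith S c m ≠ 0) :
    placed S c (lastWith S c m - 1) = insert (lastWith S c m) (placed S c m) := by
  have h1 := lastWith_le S c m
  have h2 := edgeLabel_lastWith h
  ext u
  simp only [placed, Finset.mem_filter, Finset.mem_Icc, Finset.mem_insert]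
  constructor
  · rintro ⟨hu, hu' | ⟨hu1, hu2⟩⟩
    · exact .inr ⟨hu, .inl hu'⟩
    · by_cases hum : u ≤ m
      · have := le_lastWith hum (by omega) hu1
        left; omega
      · exact .inr ⟨hu, .inr ⟨hu1, by omega⟩⟩
  · rintro (rfl | ⟨hu, hu' | ⟨hu1, hu2⟩⟩)
    · exact ⟨by omega, .inr ⟨h2, by omega⟩⟩
    · exact ⟨hu, .inl hu'⟩
    · exact ⟨hu, .inr ⟨hu1, by omega⟩⟩

theorem placed_succ {S : List ℕ} {c m : ℕ} (h : lastWith S c m = 0) :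
    placed S (c + 1) S.length = placed S c m := by
  ext u
  simp only [placed, Finset.mem_filter, Finset.mem_Icc]
  constructor
  · rintro ⟨hu, hu' | hu'⟩
    · refine ⟨hu, ?_⟩
      rcases (Nat.lt_succ_iff.1 hu').lt_or_eq with hl | hl
      · exact .inl hl
      · refine .inr ⟨hl, ?_⟩
        by_contra hc
        have := le_lastWith (not_lt.1 hc) (by omega) hl
        omega
    · omega
  · rintro ⟨hu, hu' | hu'⟩
    · exact ⟨hu, .inl (by omega)⟩
    · exact ⟨hu, .inl (by omega)⟩

/-- When a node is reached, exactly its siblings with smaller labels have been placed, since siblings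
have distinct labels. -/
theorem card_placed_siblings {S : List ℕ} {c m : ℕ} (hm : m ≤ S.length) (h : lastWith S c m ≠ 0) :
    ((placed S c m).filter fun u => parent S u = parent S (lastWith S c m)).card =
      rank S (lastWith S c m) := by
  have h1 := lastWith_le S c m
  have h2 := edgeLabel_lastWith h
  rw [rank]
  congr 1
  ext u
  simp only [placed, Finset.mem_filter, Finset.mem_Icc, mem_children]
  constructor
  · rintro ⟨⟨hu, hu' | hu'⟩, hp⟩
    · exact ⟨⟨by omega, by omega, hp⟩, by omega⟩
    · have := eq_of_parent_of_edgeLabel (by omega) (by omega) (by omega) h hp (hu'.1.trans h2.symm)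
      omega
  · rintro ⟨⟨hu, hu0, hp⟩, hl⟩
    exact ⟨⟨by omega, .inl (by omega)⟩, hp⟩

theorem runs_placeEdges {S : List ℕ} {w M : ℕ} (hfit : Fit S.length w M) {s : State}
    (h0 : s.reg 0 = S.length) (h2 : s.reg 2 = 0) (h3 : s.reg 3 = lastWith S 0 S.length)
    (h1 : ∀ p ≤ S.length + 1, s.arr 1 p = firstEdge S p)
    (h7 : ∀ u < S.length + 1, u ≠ 0 → s.arr 7 u = parent S u)
    (h13 : ∀ c, s.arr 13 c = lastWith S c S.length)
    (h14 : ∀ u < S.length + 1, u ≠ 0 → s.arr 14 u = lastWith S (edgeLabel S u) (u - 1))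
    (h15 : s.arr 15 = fun _ => 0) (τ : ℕ) :
    Runs w M placeEdges s τ fun s' τ' => (∀ u ≤ S.length, u ≠ 0 →
      s'.arr 2 (edgePos S u) = edgeLabel S u ∧ s'.arr 3 (edgePos S u) = u) ∧
      τ' ≤ τ + 60 * (2 * S.length + 1) + 10 := by
  have hw0 := hfit.ne_zero
  have hW := hfit.word
  have hM := hfit.mem
  refine Runs.loop (Inv := fun s' τ' => s'.reg 2 ≤ S.length + 1 ∧ ∃ m ≤ S.length,
    s'.reg 3 = lastWith S (s'.reg 2) m ∧
    (∀ p, s'.arr 15 p = ((placed S (s'.reg 2) m).filter fun u => parent S u = p).card) ∧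
    (∀ u ∈ placed S (s'.reg 2) m,
      s'.arr 2 (edgePos S u) = edgeLabel S u ∧ s'.arr 3 (edgePos S u) = u) ∧
    τ' ≤ τ + 60 * (s'.reg 2 + (placed S (s'.reg 2) m).card)) (τ + 60 * (2 * S.length + 1)) _ _
    ?_ ?_ ?_ ?_ ?_
  · rintro s' τ' ⟨_, m, _, _, _, _, _⟩
    have := card_placed_le S (s'.reg 2) m
    omega
  · rintro s' τ' - hF
    have h0' : s'.reg 0 = S.length := (hF.2 0 (by decide)).trans h0
    simp [Expr.Fits, Expr.val, hw0, h0']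
    omega
  · rintro s' τ' ⟨hc, m, hm, hk, hcnt, hpl, ht⟩ hF hne
    have h0' : s'.reg 0 = S.length := (hF.2 0 (by decide)).trans h0
    have e1 : s'.arr 1 = s.arr 1 := hF.1 1 (by decide)
    have e7 : s'.arr 7 = s.arr 7 := hF.1 7 (by decide)
    have e13 : s'.arr 13 = s.arr 13 := hF.1 13 (by decide)
    have e14 : s'.arr 14 = s.arr 14 := hF.1 14 (by decide)
    obtain ⟨c, hc'⟩ : ∃ c, s'.reg 2 = c := ⟨_, rfl⟩
    rw [hc'] at hc hk hcnt hpl ht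
    have hcn : c < S.length + 1 := by
      simp only [Expr.val, hc', h0'] at hne
      by_contra h; rw [if_neg h] at hne; exact hne rfl
    refine Runs.of_wp ?_
    simp only [wp, Expr.val, Expr.Fits, Expr.cost, Function.update_apply, Nat.reduceEqDiff,
      ↓reduceIte, e1, e7, e13, e14, hk, hc', h13]
    refine ⟨trivial, fun hk0 => ?_, fun hk0 => ?_⟩
    · have hins := placed_lastWith hm hk0
      have hrank := card_placed_siblings hm hk0
      have hlab := edgeLabel_lastWith hk0
      have hkm := lastWith_le S c m
      have hnot : lastWith S c m ∉ placed S c m := by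
        simp only [placed, Finset.mem_filter]; omega
      have hcard : (placed S c (lastWith S c m - 1)).card = (placed S c m).card + 1 := by
        rw [hins, Finset.card_insert_of_notMem hnot]
      have hnext := h14 (lastWith S c m) (by omega) hk0
      rw [hlab] at hnext
      generalize lastWith S c m = k at *
      have hkn : k ≤ S.length := by omega
      have hpk := (node_eq_parent_append S hkn hk0).1
      have hpos := edgePos_lt_length S hkn hk0
      have hpos' : edgePos S k = firstEdge S (parent S k) + rank S k := rfl
      rw [h7 k (by omega) hk0, h1 _ (by omega), hcnt, hrank]
      refine ⟨trivial, by omega, trivial, by omega, trivial, by omega, trivial,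
        ⟨trivial, by omega, by omega⟩, by omega, ⟨trivial, trivial, by omega⟩, trivial, trivial,
        by omega, trivial, trivial, by omega, trivial, by omega, by omega, k - 1, by omega, hnext,
        fun p => ?_, fun u hu => ?_, by omega⟩
      · rw [hins, Finset.filter_insert]
        rcases eq_or_ne p (parent S k) with rfl | hp
        · rw [if_pos rfl, if_pos rfl, Finset.card_insert_of_notMem (by simp [hnot]), hrank]
        · rw [if_neg hp, if_neg hp.symm, hcnt]
      · rw [← hpos']
        rw [hins] at hu
        rcases Finset.mem_insert.1 hu with rfl | hu
        · rw [if_pos rfl, if_pos rfl, hlab]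
          exact ⟨rfl, rfl⟩
        · have hu' := Finset.mem_Icc.1 (Finset.mem_filter.1 hu).1
          have hne : edgePos S u ≠ edgePos S k := fun h => by
            have := edgePos_inj hu'.2 (by omega) hkn hk0 h
            exact hnot (this ▸ hu)
          rw [if_neg hne, if_neg hne]
          exact hpl u hu
    · have hs := placed_succ hk0
      refine ⟨⟨trivial, by omega, by omega⟩, trivial, by omega, by omega, S.length, le_rfl, rfl,
        ?_, ?_, ?_⟩
      · rw [hs]; exact hcnt
      · rw [hs]; exact hpl
      · rw [hs]; omega
  · rintro s' τ' ⟨hc, m, hm, hk, hcnt, hpl, ht⟩ hF he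
    have h0' : s'.reg 0 = S.length := (hF.2 0 (by decide)).trans h0
    have hc' : s'.reg 2 = S.length + 1 := by
      simp only [Expr.val, h0'] at he
      by_contra hc
      rw [if_pos (by omega)] at he
      omega
    rw [hc'] at hpl ht
    have := card_placed_le S (S.length + 1) m
    refine ⟨fun u hu hu0 => hpl u ?_, ?_⟩
    · have := edgeLabel_lt S hu hu0
      simp only [placed, Finset.mem_filter, Finset.mem_Icc]
      omega
    · simp only [Expr.cost]; omega
  · have hem : placed S 0 S.length = ∅ := by
      refine Finset.filter_eq_empty_iff.2 fun u hu => ?_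
      have := Finset.mem_Icc.1 hu
      omega
    rw [h2]
    exact ⟨Nat.zero_le _, S.length, le_rfl, h3, by simp [hem, h15], by simp [hem], by omega⟩

/-! ### The whole program -/

/-- The construction of the sorted heap with its maximal reach pointers. -/
def cphProgram : Program :=
  .seq computePrv <|
  .seq (.assign 1 (.const 0)) <|
  .seq buildHeap <|
  .seq (.seq (.assign 1 (.const 0)) (.assign 2 (.const 0))) <|
  .seq computeReach <|
  .seq (.assign 1 (.const 0)) <|
  .seq sumCounts <|
  .seq (.seq (.assign 2 (.const 0)) (.load 3 13 (.const 0))) placeEdges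

theorem runs_cphProgram {S : List ℕ} {w M B : ℕ} (hfit : Fit S.length w M)
    (hB : ∀ v ≤ S.length, (node S v).count 0 < 2 ^ B) :
    Runs w M cphProgram (input S) 0 fun s τ =>
      IsSortedHeap S (s.arr 1) (s.arr 2) (s.arr 3) (s.arr 4) ∧
      τ ≤ S.length * (5 * climbCost B + 600) + 400 := by
  have hw0 := hfit.ne_zero
  have hW := hfit.word
  have hM := hfit.mem
  refine Runs.seq ((runs_computePrv hfit rfl rfl ?_ ?_ 0).mono ?_)
  · funext i; simp [input]
  · funext i; simp [input]
  rintro s₁ τ₁ hF₁ ⟨h5₁, h6₁, ht₁⟩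
  have h0₁ : s₁.reg 0 = S.length := hF₁.2 0 (by decide)
  have ha₁ : ∀ A, A ∉ [0, 5, 6] → s₁.arr A = fun _ => 0 := by
    intro A hA
    simp only [List.mem_cons, List.not_mem_nil, or_false, not_or] at hA
    rw [hF₁.1 A (by simp [computePrv, findSmaller, Program.arrs, hA])]
    funext i
    simp [input, hA]
  refine Runs.seq (Runs.of_wp ⟨Nat.two_pow_pos w, ?_⟩)
  refine Runs.seq ((runs_buildHeap (B := B) hfit hB (by exact represents_one S B ha₁)
    (by exact h5₁) (by exact h6₁) (by simpa using h0₁) (by simp [Expr.val]) _).mono ?_)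
  rintro s₂ τ₂ hF₂ ⟨hh₂, ht₂⟩
  have h0₂ : s₂.reg 0 = S.length := by rw [hF₂.2 0 (by decide)]; simpa using h0₁
  have h6₂ : s₂.arr 6 = indeg S S.length := by rw [hF₂.1 6 (by decide)]; exact h6₁
  have h15₂ : s₂.arr 15 = fun _ => 0 := by rw [hF₂.1 15 (by decide)]; exact ha₁ 15 (by decide)
  refine Runs.seq (Runs.of_wp ⟨Nat.two_pow_pos w, Nat.two_pow_pos w, ?_⟩)
  refine Runs.seq ((runs_computeReach (B := B) hfit (by exact hh₂) (by exact h6₂)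
    (by simpa using h0₂) (by simp [Expr.val]) (by simp [Expr.val]) _).mono ?_)
  rintro s₃ τ₃ hF₃ ⟨hm₃, ht₃⟩
  have h0₃ : s₃.reg 0 = S.length := by rw [hF₃.2 0 (by decide)]; simpa using h0₂
  have ha₃ : ∀ A, A ≠ 4 → s₃.arr A = s₂.arr A := fun A hA =>
    hF₃.1 A (by simpa [Program.arrs, computeReach, nextSuffix, climb, search] using hA)
  refine Runs.seq (Runs.of_wp ⟨Nat.two_pow_pos w, ?_⟩)
  refine Runs.seq ((runs_sumCounts hfit (by simpa using h0₃) (by simp [Expr.val])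
    (by simp only [ha₃ 1 (by decide)]; exact hh₂.first_zero)
    (by simp only [ha₃ 1 (by decide)]; exact hh₂.first_succ) _).mono ?_)
  rintro s₄ τ₄ hF₄ ⟨hf₄, ht₄⟩
  have h0₄ : s₄.reg 0 = S.length := by rw [hF₄.2 0 (by decide)]; simpa using h0₃
  have ha₄ : ∀ A, A ≠ 1 → A ≠ 4 → s₄.arr A = s₂.arr A := fun A hA hA' => by
    rw [hF₄.1 A (by simpa [Program.arrs, sumCounts] using hA)]; exact ha₃ A hA'
  have h13₄ : s₄.arr 13 = s₂.arr 13 := ha₄ 13 (by decide) (by decide)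
  refine Runs.seq (Runs.of_wp ⟨Nat.two_pow_pos w, Nat.two_pow_pos w, ?_, ?_⟩)
  · simp only [Expr.val]; omega
  refine (runs_placeEdges hfit (by simpa using h0₄) (by simp [Expr.val])
    (by simp [Expr.val, h13₄, hh₂.head]) (by exact hf₄)
    (by simp only [ha₄ 7 (by decide) (by decide)]; exact hh₂.parent)
    (by simp only [h13₄]; exact hh₂.head)
    (by simp only [ha₄ 14 (by decide) (by decide)]; exact hh₂.next)
    (by exact (ha₄ 15 (by decide) (by decide)).trans h15₂) _).mono ?_
  rintro s₅ τ₅ hF₅ ⟨he₅, ht₅⟩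
  have h1₅ : s₅.arr 1 = s₄.arr 1 := hF₅.1 1 (by decide)
  have h4₅ : s₅.arr 4 = s₃.arr 4 := (hF₅.1 4 (by decide)).trans (hF₄.1 4 (by decide))
  rw [h1₅, h4₅]
  refine ⟨isSortedHeap_of_edgePos hf₄ he₅ hm₃, ?_⟩
  simp only [Expr.cost] at *
  have e1 : S.length * (5 * climbCost B + 600) = S.length * (3 * climbCost B + 150) +
      S.length * (2 * climbCost B + 80) + 370 * S.length := by ring
  omega

end CartesianHeap

open CartesianHeap in
/-- There is one program that, for strings over an integer alphabet `[1..σ]` of polynomial size, computes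
the edge-sorted Cartesian-tree position heap with all maximal reach pointers, in the arrays `1`, `2`,
`3` and `4`, within `O(n log σ_S)` steps and `O(n)` space, on words of `O(log n)` bits. -/
theorem theorem2 :
    ∃ P : Program, ∀ c : ℕ, ∃ C K : ℕ, ∀ (σ w : ℕ) (S : List ℕ),
      σ ≤ (S.length + 1) ^ c →
      (∀ a ∈ S, 1 ≤ a ∧ a ≤ σ) →
      (S.length + 2) ^ K ≤ 2 ^ w →
      ∃ (s : State) (t : ℕ),
        Exec w (C * (S.length + 1)) P (input S) s t ∧
        t ≤ C * ((S.length + 1) * (1 + Nat.log 2 S.toFinset.card)) ∧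
        IsSortedHeap S (s.arr 1) (s.arr 2) (s.arr 3) (s.arr 4) := by
  -- The constants are generous: the arrays need three cells per node, and words have to hold numbers
  -- up to `4 * n + 7`, since characters are only compared.
  refine ⟨cphProgram, fun c => ⟨2000, 3, fun σ w S _ _ hw => ?_⟩⟩
  have hfit : Fit S.length w (2000 * (S.length + 1)) := by
    refine ⟨le_trans ?_ hw, by omega⟩
    have h : 4 * (S.length + 2) ≤ (S.length + 2) ^ 2 * (S.length + 2) :=
      Nat.mul_le_mul_right _ (Nat.pow_le_pow_left (show 2 ≤ S.length + 2 by omega) 2)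
    calc 4 * S.length + 8 = 4 * (S.length + 2) := by ring
      _ ≤ (S.length + 2) ^ 2 * (S.length + 2) := h
      _ = (S.length + 2) ^ 3 := by ring
  obtain ⟨s, t, hE, hs, ht⟩ := runs_cphProgram (S := S) (B := Nat.log 2 S.toFinset.card + 1) hfit
    fun v hv => (count_zero_node_le S hv).trans_lt (Nat.lt_pow_succ_log_self one_lt_two _)
  refine ⟨s, t, hE, ?_, hs⟩
  rw [climbCost] at ht
  generalize Nat.log 2 S.toFinset.card = L at *
  nlinarith [Nat.zero_le (S.length * L)]
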